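/- Let $(\overline M, g)$ be a Riemannian manifold with Levi-Civita connection $\overline\nabla$, carrying a globally framed metric $f$-structure $(\varphi, \xi_k, \eta^k, g)$, $1\le k\le s$: a $(1,1)$-tensor field $\varphi$, vector fields $\xi_k$ and $1$-forms $\eta^k$ with $\eta^j(\xi_i)=\delta_i^j$, $\varphi^2=-I+\sum_k\eta^k\otimes\xi_k$, $\eta^k(X)=g(X,\xi_k)$ and $g(\varphi X,\varphi Y)=g(X,Y)-\sum_k\eta^k(X)\eta^k(Y)$. Assume that $\overline M$ is a nearly Kenmotsu $f$-manifold, that is, $$(\overline\nabla_X\varphi)Y+(\overline\nabla_Y\varphi)X=-\sum_{k=1}^s\{\eta^k(X)\varphi Y+\eta^k(Y)\varphi X\}$$ for all vector fields $X,Y$ on $\overline M$. Let $(M_\perp,g_\perp)$ and $(M_\theta,g_\theta)$ be Riemannian manifolds, let $f$ be a positive smooth function on $M_\perp$, and let $M=M_\perp\times_f M_\theta$ be the warped product, i.e. $M_\perp\times M_\theta$ with the metric $g_\perp+f^2g_\theta$. Let $M$ be isometrically immersed in $\overline M$ as a pseudo-slant submanifold with the structure vector fields tangent to $M_\perp$: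 writing $D^\perp$ and $D_\theta$ for the distributions of $M$ tangent to the leaves $M_\perp\times\{q\}$ and $\{p\}\times M_\theta$, each $\xi_k$ lies in $D^\perp$ along $M$, $\varphi(D^\perp)$ is normal to $M$, and there is a constant $\theta\in[0,\pi/2]$ such that for every nonzero $X\in D_\theta$ the angle between $\varphi X$ and $D_\theta$ is $\theta$. Suppose that $M$ is totally geodesic in $\overline M$, i.e. its second fundamental form vanishes. Then at least one of the following statements is true: (i) $M$ is an anti-invariant submanifold, i.e. $\varphi(T_xM)\subset T_x^\perp M$ for all $x\in M$; (ii) $M$ is an invariant submanifold, i.e. $\varphi(T_xM)\subset T_xM$ for all $x\in M$; (iii) $Z(\ln f)=\sum_{k=1}^s\eta^k(Z)$ for every vector $Z$ tangent to $M_\perp$ (regarded, on the right-hand side, as tangent to the leaf $M_\perp\times\{q\}$ through any point $(p,q)$ of $M$). -/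

import Mathlib

open Bundle Manifold
open scoped ContDiff Topology

noncomputable section

namespace WarpedPseudoSlant

section Ambient

variable {E : Type*} [NormedAddCommGroup E] [NormedSpace ℝ E] [FiniteDimensional ℝ E]
  {N : Type*} [TopologicalSpace N] [ChartedSpace E N] [IsManifold 𝓘(ℝ, E) ∞ N]
  [RiemannianBundle (fun x : N => TangentSpace 𝓘(ℝ, E) x)]
  [IsContMDiffRiemannianBundle 𝓘(ℝ, E) ∞ E (fun x : N => TangentSpace 𝓘(ℝ, E) x)]

instance instFiniteDimensionalTangentSpace (x : N) :
    FiniteDimensional ℝ (TangentSpace 𝓘(ℝ, E) x) :=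
  inferInstanceAs (FiniteDimensional ℝ E)

instance instHasOrthogonalProjection (x : N) (K : Submodule ℝ (TangentSpace 𝓘(ℝ, E) x)) :
    K.HasOrthogonalProjection :=
  haveI : CompleteSpace K := FiniteDimensional.complete ℝ K
  inferInstance

/-- `D` is the Levi-Civita connection of the Riemannian metric of `N`: the (unique) covariant
derivative on the tangent bundle that is compatible with the metric,
`v ⟨Y, Z⟩ = ⟨∇_v Y, Z⟩ + ⟨Y, ∇_v Z⟩`, and has no torsion.
As in Mathlib, `D Y x v` is `∇_v Y` at the point `x`. -/
structure IsLeviCivita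
    (D : CovariantDerivative 𝓘(ℝ, E) E (fun x : N => TangentSpace 𝓘(ℝ, E) x)) : Prop where
  metric : ∀ (x : N) (Y Z : ∀ x : N, TangentSpace 𝓘(ℝ, E) x) (v : TangentSpace 𝓘(ℝ, E) x),
    MDifferentiableAt 𝓘(ℝ, E) (𝓘(ℝ, E).prod 𝓘(ℝ, E))
      (fun y : N => TotalSpace.mk' E (E := fun x : N => TangentSpace 𝓘(ℝ, E) x) y (Y y)) x →
    MDifferentiableAt 𝓘(ℝ, E) (𝓘(ℝ, E).prod 𝓘(ℝ, E))
      (fun y : N => TotalSpace.mk' E (E := fun x : N => TangentSpace 𝓘(ℝ, E) x) y (Z y)) x →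
    mvfderiv 𝓘(ℝ, E) (fun y : N => (inner ℝ (Y y) (Z y) : ℝ)) x v =
      inner ℝ (D Y x v) (Z x) + inner ℝ (Y x) (D Z x v)
  torsion : D.torsion = 0

variable (E N) in
/-- A globally framed metric `f`-structure `(φ, ξ_i, η^i, g)` with `s` structure vector fields, `g`
being the Riemannian metric of `N`. The identities force the rank of `φ` to be constant and even,
so `dim N = 2m + s`. -/
structure FramedMetricFStructure (s : ℕ) where
  /-- the `(1, 1)` tensor field -/
  φ : ∀ x : N, TangentSpace 𝓘(ℝ, E) x →L[ℝ] TangentSpace 𝓘(ℝ, E) x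
  /-- the structure vector fields -/
  ξ : Fin s → ∀ x : N, TangentSpace 𝓘(ℝ, E) x
  /-- the dual one-forms -/
  η : Fin s → ∀ x : N, TangentSpace 𝓘(ℝ, E) x →L[ℝ] ℝ
  contMDiff_φ : ContMDiff 𝓘(ℝ, E) (𝓘(ℝ, E).prod 𝓘(ℝ, E →L[ℝ] E)) ∞
    (fun x : N => TotalSpace.mk' (E →L[ℝ] E)
      (E := fun x : N => TangentSpace 𝓘(ℝ, E) x →L[ℝ] TangentSpace 𝓘(ℝ, E) x) x (φ x))
  contMDiff_ξ : ∀ i, ContMDiff 𝓘(ℝ, E) (𝓘(ℝ, E).prod 𝓘(ℝ, E)) ∞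
    (fun x : N => TotalSpace.mk' E (E := fun x : N => TangentSpace 𝓘(ℝ, E) x) x (ξ i x))
  η_ξ : ∀ i j x, η j x (ξ i x) = if i = j then 1 else 0
  φ_φ : ∀ x v, φ x (φ x v) = -v + ∑ i, η i x v • ξ i x
  η_eq : ∀ i x v, η i x v = inner ℝ v (ξ i x)
  inner_φ_φ : ∀ x v w, inner ℝ (φ x v) (φ x w) = inner ℝ v w - ∑ i, η i x v * η i x w

/-- The covariant derivative of an endomorphism field: `(∇_v φ) Y = ∇_v (φ Y) - φ (∇_v Y)`. -/
def covDerivEnd (D : CovariantDerivative 𝓘(ℝ, E) E (fun x : N => TangentSpace 𝓘(ℝ, E) x))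
    (φ : ∀ x : N, TangentSpace 𝓘(ℝ, E) x →L[ℝ] TangentSpace 𝓘(ℝ, E) x)
    (Y : ∀ x : N, TangentSpace 𝓘(ℝ, E) x) (x : N) (v : TangentSpace 𝓘(ℝ, E) x) :
    TangentSpace 𝓘(ℝ, E) x :=
  D (fun y => φ y (Y y)) x v - φ x (D Y x v)

/-- The structure is nearly Kenmotsu with respect to the connection `D`:
`(∇_X φ) Y + (∇_Y φ) X = - ∑ k, (η^k(X) φ Y + η^k(Y) φ X)`. Both sides are tensorial in `X` and
`Y`, so it makes no difference how smooth these are required to be. -/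
def IsNearlyKenmotsu {s : ℕ} (S : FramedMetricFStructure E N s)
    (D : CovariantDerivative 𝓘(ℝ, E) E (fun x : N => TangentSpace 𝓘(ℝ, E) x)) : Prop :=
  ∀ (x : N) (X Y : ∀ x : N, TangentSpace 𝓘(ℝ, E) x),
    MDifferentiableAt 𝓘(ℝ, E) (𝓘(ℝ, E).prod 𝓘(ℝ, E))
      (fun y : N => TotalSpace.mk' E (E := fun x : N => TangentSpace 𝓘(ℝ, E) x) y (X y)) x →
    MDifferentiableAt 𝓘(ℝ, E) (𝓘(ℝ, E).prod 𝓘(ℝ, E))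
      (fun y : N => TotalSpace.mk' E (E := fun x : N => TangentSpace 𝓘(ℝ, E) x) y (Y y)) x →
    covDerivEnd D S.φ Y x (X x) + covDerivEnd D S.φ X x (Y x) =
      -∑ k, (S.η k x (X x) • S.φ x (Y x) + S.η k x (Y x) • S.φ x (X x))

end Ambient

section Submanifold

variable {E : Type*} [NormedAddCommGroup E] [NormedSpace ℝ E] [FiniteDimensional ℝ E]
  {N : Type*} [TopologicalSpace N] [ChartedSpace E N] [IsManifold 𝓘(ℝ, E) ∞ N]
  [RiemannianBundle (fun x : N => TangentSpace 𝓘(ℝ, E) x)]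
  [IsContMDiffRiemannianBundle 𝓘(ℝ, E) ∞ E (fun x : N => TangentSpace 𝓘(ℝ, E) x)]
  {F : Type*} [NormedAddCommGroup F] [NormedSpace ℝ F]
  {H : Type*} [TopologicalSpace H] (I : ModelWithCorners ℝ F H)
  {M : Type*} [TopologicalSpace M] [ChartedSpace H M]

/-- The tangent space at `x` of the submanifold immersed by `ι`, as a subspace of the ambient
tangent space. -/
def tangent (ι : M → N) (x : M) : Submodule ℝ (TangentSpace 𝓘(ℝ, E) (ι x)) :=
  (mfderiv I 𝓘(ℝ, E) ι x).range

/-- The ambient vector field `Y` is tangent to the immersed submanifold at all of its points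
near `x`. -/
def IsTangentNear (ι : M → N) (x : M) (Y : ∀ z : N, TangentSpace 𝓘(ℝ, E) z) : Prop :=
  ∀ᶠ y in 𝓝 x, Y (ι y) ∈ tangent I ι y

/-- The second fundamental form `h(u, Y)` at `x`: the normal component of `∇_u Y`, where `∇` is
the ambient connection `D`, `u` is a tangent vector of the submanifold at `x`, and `Y` is a vector
field of the submanifold, extended to the ambient manifold. -/
def secondFundamentalForm
    (D : CovariantDerivative 𝓘(ℝ, E) E (fun x : N => TangentSpace 𝓘(ℝ, E) x))
    (ι : M → N) (x : M) (u : TangentSpace I x) (Y : ∀ z : N, TangentSpace 𝓘(ℝ, E) z) :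
    TangentSpace 𝓘(ℝ, E) (ι x) :=
  (tangent I ι x)ᗮ.starProjection (D Y (ι x) (mfderiv I 𝓘(ℝ, E) ι x u))

/-- The immersed submanifold is totally geodesic: `h(u, Y) = 0` for every tangent vector `u` and
every vector field `Y` of the submanifold, extended to the ambient manifold. (As `h(u, Y)` at `x`
depends on `Y` only through its value at `x`, it makes no difference how smooth `Y` is required to
be.) -/
def IsTotallyGeodesic
    (D : CovariantDerivative 𝓘(ℝ, E) E (fun x : N => TangentSpace 𝓘(ℝ, E) x))
    (ι : M → N) : Prop :=
  ∀ (x : M) (u : TangentSpace I x) (Y : ∀ z : N, TangentSpace 𝓘(ℝ, E) z),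
    MDifferentiableAt 𝓘(ℝ, E) (𝓘(ℝ, E).prod 𝓘(ℝ, E))
      (fun z : N => TotalSpace.mk' E (E := fun x : N => TangentSpace 𝓘(ℝ, E) x) z (Y z)) (ι x) →
    IsTangentNear I ι x Y →
    secondFundamentalForm I D ι x u Y = 0

/-- `φ` maps every tangent space of the submanifold into itself. -/
def IsInvariant {s : ℕ} (S : FramedMetricFStructure E N s) (ι : M → N) : Prop :=
  ∀ x, ∀ v ∈ tangent I ι x, S.φ (ι x) v ∈ tangent I ι x

/-- `φ` maps every tangent space of the submanifold into the normal space. -/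
def IsAntiInvariant {s : ℕ} (S : FramedMetricFStructure E N s) (ι : M → N) : Prop :=
  ∀ x, ∀ v ∈ tangent I ι x, S.φ (ι x) v ∈ (tangent I ι x)ᗮ

/-- The angle between a vector `w` and a subspace `K`, that is between `w` and its orthogonal
projection to `K` (it is `π / 2` if `w` is orthogonal to `K`). -/
def angleWith {x : N} (w : TangentSpace 𝓘(ℝ, E) x) (K : Submodule ℝ (TangentSpace 𝓘(ℝ, E) x)) :
    ℝ :=
  InnerProductGeometry.angle w (K.starProjection w)

end Submanifold

section WarpedProduct

variable {E : Type*} [NormedAddCommGroup E] [NormedSpace ℝ E] [FiniteDimensional ℝ E]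
  {N : Type*} [TopologicalSpace N] [ChartedSpace E N] [IsManifold 𝓘(ℝ, E) ∞ N]
  [RiemannianBundle (fun x : N => TangentSpace 𝓘(ℝ, E) x)]
  [IsContMDiffRiemannianBundle 𝓘(ℝ, E) ∞ E (fun x : N => TangentSpace 𝓘(ℝ, E) x)]
  {E₁ : Type*} [NormedAddCommGroup E₁] [NormedSpace ℝ E₁]
  {M₁ : Type*} [TopologicalSpace M₁] [ChartedSpace E₁ M₁]
  {E₂ : Type*} [NormedAddCommGroup E₂] [NormedSpace ℝ E₂]
  {M₂ : Type*} [TopologicalSpace M₂] [ChartedSpace E₂ M₂]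

/-- The distribution of `M₁ × M₂`, immersed by `ι`, that is tangent to the leaves
`M₁ × {q}`. -/
def firstDistribution (ι : M₁ × M₂ → N) (x : M₁ × M₂) :
    Submodule ℝ (TangentSpace 𝓘(ℝ, E) (ι x)) :=
  (mfderiv 𝓘(ℝ, E₁) 𝓘(ℝ, E) (fun p : M₁ => ι (p, x.2)) x.1).range

/-- The distribution of `M₁ × M₂`, immersed by `ι`, that is tangent to the leaves
`{p} × M₂`. -/
def secondDistribution (ι : M₁ × M₂ → N) (x : M₁ × M₂) :
    Submodule ℝ (TangentSpace 𝓘(ℝ, E) (ι x)) :=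
  (mfderiv 𝓘(ℝ, E₂) 𝓘(ℝ, E) (fun q : M₂ => ι (x.1, q)) x.2).range

/-- The metric induced by `ι` on `M₁ × M₂` is the warped product metric `g₁ + f² g₂`. -/
def IsWarpedProductIsometric [RiemannianBundle (fun p : M₁ => TangentSpace 𝓘(ℝ, E₁) p)]
    [RiemannianBundle (fun q : M₂ => TangentSpace 𝓘(ℝ, E₂) q)]
    (f : M₁ → ℝ) (ι : M₁ × M₂ → N) : Prop :=
  ∀ (x : M₁ × M₂) (u v : TangentSpace (𝓘(ℝ, E₁).prod 𝓘(ℝ, E₂)) x),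
    inner ℝ (mfderiv (𝓘(ℝ, E₁).prod 𝓘(ℝ, E₂)) 𝓘(ℝ, E) ι x u)
        (mfderiv (𝓘(ℝ, E₁).prod 𝓘(ℝ, E₂)) 𝓘(ℝ, E) ι x v) =
      inner ℝ (mfderiv (𝓘(ℝ, E₁).prod 𝓘(ℝ, E₂)) 𝓘(ℝ, E₁) Prod.fst x u)
          (mfderiv (𝓘(ℝ, E₁).prod 𝓘(ℝ, E₂)) 𝓘(ℝ, E₁) Prod.fst x v) +
        f x.1 ^ 2 * inner ℝ (mfderiv (𝓘(ℝ, E₁).prod 𝓘(ℝ, E₂)) 𝓘(ℝ, E₂) Prod.snd x u)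
          (mfderiv (𝓘(ℝ, E₁).prod 𝓘(ℝ, E₂)) 𝓘(ℝ, E₂) Prod.snd x v)

/-- The product `M₁ × M₂`, immersed by `ι`, is pseudo-slant with anti-invariant factor
`M₁ = M_⊥`, to which the structure vector fields are tangent, and with slant factor `M₂ = M_θ` of
slant angle `θ`. (The two distributions are complementary in the tangent bundle because `M₁ × M₂`
is a product; they are orthogonal when the induced metric is a warped product metric.) The right
angle `θ = π / 2` is not excluded. -/
structure IsPseudoSlant {s : ℕ} (S : FramedMetricFStructure E N s) (ι : M₁ × M₂ → N) (θ : ℝ) :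
    Prop where
  ξ_mem : ∀ k x, S.ξ k (ι x) ∈ firstDistribution (E₁ := E₁) ι x
  antiInvariant : ∀ x, ∀ v ∈ firstDistribution (E₁ := E₁) (E := E) ι x,
    S.φ (ι x) v ∈ (tangent (𝓘(ℝ, E₁).prod 𝓘(ℝ, E₂)) ι x)ᗮ
  angle_mem : θ ∈ Set.Icc 0 (Real.pi / 2)
  slant : ∀ x, ∀ v ∈ secondDistribution (E₂ := E₂) (E := E) ι x, v ≠ 0 →
    angleWith (S.φ (ι x) v) (secondDistribution (E₂ := E₂) ι x) = θ

end WarpedProduct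

end WarpedPseudoSlant

end

set_option linter.unusedSectionVars false

/-! If `cos θ = 0` or the slant factor is zero-dimensional, φ sends `D_θ` into its own orthogonal
complement, and with the condition on `D^⊥` this gives (i). Otherwise (iii) holds at every point, so
the alternative (ii) is never needed.

For (iii), let Z be a coordinate field of `M_⊥`, let b, b' be coordinate fields of `M_θ`, and put μ
= Z(ln f), ω = g(φb, b'). The Koszul computation for the warped metric, with M totally geodesic,
gives ∇_b Z = μb modulo `D^⊥`. Since g(φZ, b') = 0 along M and ∇_b b' is tangent, g((∇_b φ)Z, b') =
-μω. The nearly Kenmotsu identity then yields g((∇_Z φ)b, b') = (μ - Σ η^k(Z))ω, and the product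
rule gives Zω = (3μ - Σ η^k(Z))ω.

On the other hand, Cauchy–Schwarz and the slant condition give ω² ≤ cos²θ |b|²|b'|² everywhere, with
equality at a chosen point when b' is there the `D_θ`-projection of φb. The difference of the two
sides has an extremum at that point, so its Z-derivative vanishes: 2(3μ - Σ η^k(Z))ω² = 4μω². As ω ≠
0 there, μ = Σ η^k(Z).

`warping_eq_sum_η` carries this argument in a parametrization. `exists_extension_coordinate_fields`
supplies the ambient fields on which the connection acts, and
`IsPseudoSlant.exists_inner_φ_second_sq_eq` the choice of b'. -/

namespace WarpedPseudoSlant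

/-! ### Extending coordinate fields of an immersion to commuting ambient fields. -/

section Straightening

variable {E : Type*} [NormedAddCommGroup E] [NormedSpace ℝ E] [FiniteDimensional ℝ E]
  {V : Type*} [NormedAddCommGroup V] [NormedSpace ℝ V] [FiniteDimensional ℝ V]

/-- An immersion between finite-dimensional vector spaces can be straightened near a point. -/
theorem exists_straightening {h : V → E} {u₀ : V} (hh : ContDiffAt ℝ ∞ h u₀)
    (hinj : Function.Injective (fderiv ℝ h u₀)) :
    ∃ (C : Submodule ℝ E) (Ψ : E → V × C), ContDiffAt ℝ ∞ Ψ (h u₀) ∧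
      (∀ᶠ z in 𝓝 (h u₀), (fderiv ℝ Ψ z).IsInvertible) ∧ ∀ᶠ u in 𝓝 u₀, Ψ (h u) = (u, 0) := by
  obtain ⟨C, hC⟩ := (fderiv ℝ h u₀).range.exists_isCompl
  set A := fderiv ℝ h u₀ with hA
  -- Thickening `h` by a complement `C` of the image of its differential makes the differential
  -- bijective; `Ψ` is the local inverse of `Φ`.
  let Φ : V × C → E := fun p => h p.1 + p.2
  have hΦ : ContDiffAt ℝ ∞ Φ (u₀, 0) := by
    have h1 : ContDiffAt ℝ ∞ (fun p : V × C => h p.1) (u₀, 0) :=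
      ContDiffAt.comp (u₀, (0 : C)) (g := h) hh contDiffAt_fst
    exact h1.add (C.subtypeL.contDiff.contDiffAt.comp _ contDiffAt_snd)
  have hΦ' : HasFDerivAt Φ (A.coprod C.subtypeL) (u₀, 0) := by
    have h1 : HasFDerivAt (fun p : V × C => h p.1) (A ∘L .fst ℝ V C) (u₀, 0) :=
      HasFDerivAt.comp (u₀, (0 : C)) (g := h)
        (hh.differentiableAt (by simp)).hasFDerivAt hasFDerivAt_fst
    have h2 : HasFDerivAt (fun p : V × C => (p.2 : E)) (C.subtypeL ∘L .snd ℝ V C) (u₀, 0) :=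
      (C.subtypeL ∘L .snd ℝ V C).hasFDerivAt
    exact (h1.add h2).congr_fderiv (by ext <;> simp)
  have hker : (A.coprod C.subtypeL).ker = ⊥ := by
    rw [LinearMap.ker_eq_bot']
    rintro ⟨v, c⟩ hvc
    have hvc : A v + c = 0 := by simpa using hvc
    have hc : (c : E) ∈ A.range ⊓ C :=
      ⟨⟨-v, by simpa using neg_eq_of_add_eq_zero_right hvc⟩, c.2⟩
    rw [hC.inf_eq_bot, Submodule.mem_bot] at hc
    have hc0 : c = 0 := Subtype.ext hc
    subst hc0
    have : A v = A 0 := by simpa using hvc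
    simpa using hinj this
  have hrange : (A.coprod C.subtypeL).range = ⊤ := by
    rw [eq_top_iff, ← hC.sup_eq_top]
    refine sup_le ?_ ?_
    · rintro _ ⟨v, rfl⟩
      exact ⟨(v, 0), by simp⟩
    · intro c hc
      exact ⟨(0, ⟨c, hc⟩), by simp⟩
  let e : (V × C) ≃L[ℝ] E := ContinuousLinearEquiv.ofBijective _ hker hrange
  have hΦe : HasFDerivAt Φ (e : V × C →L[ℝ] E) (u₀, 0) := by
    exact hΦ'.congr_fderiv (by ext <;> simp [e])
  have hΦ0 : Φ (u₀, 0) = h u₀ := by simp [Φ]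
  have hs := hΦ.hasStrictFDerivAt' hΦe (by simp)
  refine ⟨C, hΦ.localInverse hΦe (by simp), ?_, ?_, ?_⟩
  · have := hΦ.to_localInverse hΦe (by simp)
    rwa [hΦ0] at this
  · have := hs.to_localInverse.hasFDerivAt.fderiv
    rw [hΦ0] at this
    have hc := hΦ.to_localInverse hΦe (by simp)
    rw [hΦ0] at hc
    have hc' := (hc.fderiv_right (m := 0) (by simp)).continuousAt
    -- Invertible operators form an open set, so invertibility of the derivative at the point
    -- spreads to a neighbourhood by continuity.
    have hnhds : Set.range ((↑) : (E ≃L[ℝ] V × C) → E →L[ℝ] V × C) ∈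
        𝓝 (fderiv ℝ (hΦ.localInverse hΦe (by simp)) (h u₀)) := by
      have h3 := ContinuousLinearEquiv.nhds e.symm
      rw [← this] at h3
      exact h3
    exact hc'.eventually hnhds
  · have h1 := hs.eventually_left_inverse
    have h2 : Filter.Tendsto (fun u : V => (u, (0 : C))) (𝓝 u₀) (𝓝 (u₀, 0)) :=
      (Continuous.prodMk continuous_id continuous_const).tendsto u₀
    filter_upwards [h2.eventually h1] with u hu
    have : Φ (u, 0) = h u := by simp [Φ]
    rw [← this]
    exact hu

variable {N : Type*} [TopologicalSpace N] [ChartedSpace E N] [IsManifold 𝓘(ℝ, E) ∞ N]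

theorem exists_straightening_manifold {j : V → N} {u₀ : V}
    (hj : ContMDiffAt 𝓘(ℝ, V) 𝓘(ℝ, E) ∞ j u₀)
    (hinj : Function.Injective (mfderiv 𝓘(ℝ, V) 𝓘(ℝ, E) j u₀)) :
    ∃ (C : Submodule ℝ E) (Θ : N → V × C), ContMDiffAt 𝓘(ℝ, E) 𝓘(ℝ, V × C) ∞ Θ (j u₀) ∧
      (∀ᶠ z in 𝓝 (j u₀), (mfderiv 𝓘(ℝ, E) 𝓘(ℝ, V × C) Θ z).IsInvertible) ∧
      ∀ᶠ u in 𝓝 u₀, Θ (j u) = (u, 0) := by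
  set ψ := extChartAt 𝓘(ℝ, E) (j u₀) with hψ
  have hψs : ContMDiffAt 𝓘(ℝ, E) 𝓘(ℝ, E) ∞ ψ (j u₀) := contMDiffAt_extChartAt
  have hψi : (mfderiv 𝓘(ℝ, E) 𝓘(ℝ, E) ψ (j u₀)).IsInvertible :=
    isInvertible_mfderiv_extChartAt (mem_extChartAt_source _)
  have hh : ContMDiffAt 𝓘(ℝ, V) 𝓘(ℝ, E) ∞ (ψ ∘ j) u₀ := hψs.comp u₀ hj
  have hinj' : Function.Injective (fderiv ℝ (ψ ∘ j) u₀) := by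
    rw [← mfderiv_eq_fderiv, mfderiv_comp u₀ (hψs.mdifferentiableAt (by simp))
      (hj.mdifferentiableAt (by simp))]
    obtain ⟨e, he⟩ := hψi
    rw [← he]
    exact e.injective.comp hinj
  obtain ⟨C, Ψ, hΨ, hΨi, hΨe⟩ := exists_straightening hh.contDiffAt hinj'
  refine ⟨C, Ψ ∘ ψ, ?_, ?_, hΨe⟩
  · exact ContMDiffAt.comp (j u₀) hΨ.contMDiffAt hψs
  · have hΨd : ∀ᶠ z in 𝓝 (ψ (j u₀)), ContDiffAt ℝ 1 Ψ z :=
      (hΨ.of_le (by norm_cast)).eventually (by simp)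
    filter_upwards [hψs.continuousAt.eventually hΨi, hψs.continuousAt.eventually hΨd,
      extChartAt_source_mem_nhds (I := 𝓘(ℝ, E)) (j u₀)] with z h1 h2 h3
    rw [mfderiv_comp z (I' := 𝓘(ℝ, E)) (h2.contMDiffAt.mdifferentiableAt (by simp))
      (mdifferentiableAt_extChartAt (by simpa using h3)), mfderiv_eq_fderiv]
    exact ContinuousLinearMap.IsInvertible.comp h1 (isInvertible_mfderiv_extChartAt h3)

/-- The coordinate vector fields of an immersion of a vector space extend, near a point, to
ambient vector fields that commute at that point. -/
theorem exists_extension_coordinate_fields {j : V → N} {u₀ : V}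
    (hj : ContMDiffAt 𝓘(ℝ, V) 𝓘(ℝ, E) ∞ j u₀)
    (hinj : Function.Injective (mfderiv 𝓘(ℝ, V) 𝓘(ℝ, E) j u₀)) :
    ∃ Y : V → ∀ z : N, TangentSpace 𝓘(ℝ, E) z,
      (∀ w, MDifferentiableAt 𝓘(ℝ, E) (𝓘(ℝ, E).prod 𝓘(ℝ, E))
        (fun z : N => TotalSpace.mk' E (E := fun x : N => TangentSpace 𝓘(ℝ, E) x) z (Y w z))
        (j u₀)) ∧
      (∀ᶠ u in 𝓝 u₀, ∀ w, Y w (j u) = mfderiv 𝓘(ℝ, V) 𝓘(ℝ, E) j u w) ∧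
      ∀ w w', VectorField.mlieBracket 𝓘(ℝ, E) (Y w) (Y w') (j u₀) = 0 := by
  obtain ⟨C, Θ, hΘ, hΘi, hΘj⟩ := exists_straightening_manifold hj hinj
  -- Constant fields commute, and pullback by `Θ` preserves brackets, so their pullbacks are the
  -- required extensions.
  let K : V → ∀ p : V × C, TangentSpace 𝓘(ℝ, V × C) p := fun w _ => (w, 0)
  have hK : ∀ w, MDifferentiableAt 𝓘(ℝ, V × C) (𝓘(ℝ, V × C).prod 𝓘(ℝ, V × C))
      (fun z : V × C => TotalSpace.mk' (V × C)
        (E := fun x : V × C => TangentSpace 𝓘(ℝ, V × C) x) z (K w z)) (Θ (j u₀)) := by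
    intro w
    rw [mdifferentiableAt_section]
    simp [K]
    exact mdifferentiableAt_const
  refine ⟨fun w => VectorField.mpullback 𝓘(ℝ, E) 𝓘(ℝ, V × C) Θ (K w), ?_, ?_, ?_⟩
  · intro w
    exact MDifferentiableAt.mpullback_vectorField (n := ∞) (hK w) hΘ
      hΘi.self_of_nhds (by norm_cast)
  · have hj' : ∀ᶠ u in 𝓝 u₀, ContMDiffAt 𝓘(ℝ, V) 𝓘(ℝ, E) 1 j u :=
      (contMDiffAt_iff_contMDiffAt_nhds (by simp)).1 (hj.of_le (by norm_cast))
    have hΘ' : ∀ᶠ z in 𝓝 (j u₀), ContMDiffAt 𝓘(ℝ, E) 𝓘(ℝ, V × C) 1 Θ z :=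
      (contMDiffAt_iff_contMDiffAt_nhds (by simp)).1 (hΘ.of_le (by norm_cast))
    filter_upwards [hj', hj.continuousAt.eventually hΘ', hj.continuousAt.eventually hΘi,
      hΘj.eventually_nhds] with u h1 h2 h3 h4 w
    -- Near `u₀`, `Θ ∘ j` is the inclusion, so `dΘ` sends `dj w` to `(w, 0)`; inverting `dΘ`
    -- identifies the pullback with `dj w`.
    have h5 : mfderiv 𝓘(ℝ, V) 𝓘(ℝ, V × C) (Θ ∘ j) u = ContinuousLinearMap.inl ℝ V C := by
      rw [Filter.EventuallyEq.mfderiv_eq 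
        (show (Θ ∘ j) =ᶠ[𝓝 u] (ContinuousLinearMap.inl ℝ V C : V → V × C) from h4)]
      rw [mfderiv_eq_fderiv]
      exact ContinuousLinearMap.fderiv _
    rw [mfderiv_comp u (h2.mdifferentiableAt (by simp)) (h1.mdifferentiableAt (by simp))] at h5
    obtain ⟨e, he⟩ := h3
    rw [← he] at h5
    have h6 : e (mfderiv 𝓘(ℝ, V) 𝓘(ℝ, E) j u w) = ((w, 0) : V × C) := congr($h5 w)
    rw [VectorField.mpullback_apply, ← he, ContinuousLinearMap.inverse_equiv]
    exact (e.symm_apply_eq).2 h6.symm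
  · intro w w'
    have : IsManifold 𝓘(ℝ, E) (minSmoothness ℝ 2) N := by
      rw [minSmoothness_of_isRCLikeNormedField]
      infer_instance
    have : IsManifold 𝓘(ℝ, V × C) (minSmoothness ℝ 2) (V × C) := by
      rw [minSmoothness_of_isRCLikeNormedField]
      infer_instance
    rw [← VectorField.mpullback_mlieBracket (hK w) (hK w') (n := ∞) hΘ
      (by simpa using (by norm_cast : (2 : WithTop ℕ∞) ≤ ∞))]
    have : VectorField.mlieBracket 𝓘(ℝ, V × C) (K w) (K w') = 0 := by
      ext1 z
      rw [← VectorField.mlieBracketWithin_univ, VectorField.mlieBracketWithin_eq_lieBracketWithin]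
      simp [VectorField.lieBracketWithin, K]
      rfl
    rw [this, VectorField.mpullback_zero]
    rfl

end Straightening

/-! ### Pointwise algebra of the framed structure, and differentiation along a submanifold. -/

section Pointwise

variable {E : Type*} [NormedAddCommGroup E] [NormedSpace ℝ E] [FiniteDimensional ℝ E]
  {N : Type*} [TopologicalSpace N] [ChartedSpace E N] [IsManifold 𝓘(ℝ, E) ∞ N]
  [RiemannianBundle (fun x : N => TangentSpace 𝓘(ℝ, E) x)]
  [IsContMDiffRiemannianBundle 𝓘(ℝ, E) ∞ E (fun x : N => TangentSpace 𝓘(ℝ, E) x)]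
  {s : ℕ} (S : FramedMetricFStructure E N s)

namespace FramedMetricFStructure

theorem φ_ξ (i : Fin s) (x : N) : S.φ x (S.ξ i x) = 0 := by
  have h := S.inner_φ_φ x (S.ξ i x) (S.ξ i x)
  rw [← S.η_eq, S.η_ξ, if_pos rfl] at h
  simp_rw [S.η_ξ] at h
  simpa using h

/-- Computing φ³v as φ²(φv) and as φ(φ²v), with φξ = 0, leaves Σ η^k(φv) ξ_k = 0; applying η^i
isolates one coefficient. -/
theorem η_φ (i : Fin s) (x : N) (v : TangentSpace 𝓘(ℝ, E) x) : S.η i x (S.φ x v) = 0 := by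
  have h1 := S.φ_φ x (S.φ x v)
  rw [S.φ_φ x v, map_add, map_neg, map_sum] at h1
  simp only [map_smul, S.φ_ξ, smul_zero, Finset.sum_const_zero, add_zero] at h1
  have h2 : ∑ k, S.η k x (S.φ x v) • S.ξ k x = 0 := by simpa using h1
  have h3 := congrArg (S.η i x) h2
  rw [map_sum, map_zero] at h3
  simpa [S.η_ξ] using h3

theorem inner_φ_left (x : N) (v w : TangentSpace 𝓘(ℝ, E) x) :
    (inner ℝ (S.φ x v) w : ℝ) = -inner ℝ v (S.φ x w) := by
  have h := S.inner_φ_φ x v (S.φ x w)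
  simp only [S.η_φ, mul_zero, Finset.sum_const_zero, sub_zero] at h
  rw [S.φ_φ, inner_add_right, inner_neg_right, inner_sum] at h
  simp only [inner_smul_right, ← S.η_eq, S.η_φ, mul_zero, Finset.sum_const_zero, add_zero] at h
  linarith

theorem norm_φ (x : N) (v : TangentSpace 𝓘(ℝ, E) x) (hv : ∀ i, S.η i x v = 0) :
    ‖S.φ x v‖ = ‖v‖ := by
  have h := S.inner_φ_φ x v v
  simp only [hv, mul_zero, Finset.sum_const_zero, sub_zero, real_inner_self_eq_norm_sq] at h
  exact (sq_eq_sq₀ (norm_nonneg _) (norm_nonneg _)).1 h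

theorem mdifferentiableAt_φ {x : N} {Y : ∀ z : N, TangentSpace 𝓘(ℝ, E) z}
    (hY : MDifferentiableAt 𝓘(ℝ, E) (𝓘(ℝ, E).prod 𝓘(ℝ, E))
      (fun z : N => TotalSpace.mk' E (E := fun x : N => TangentSpace 𝓘(ℝ, E) x) z (Y z)) x) :
    MDifferentiableAt 𝓘(ℝ, E) (𝓘(ℝ, E).prod 𝓘(ℝ, E))
      (fun z : N => TotalSpace.mk' E (E := fun x : N => TangentSpace 𝓘(ℝ, E) x) z
        (S.φ z (Y z))) x :=
  MDifferentiableAt.clm_bundle_apply (F₁ := E) (F₂ := E)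
    (E₁ := fun x : N => TangentSpace 𝓘(ℝ, E) x) (E₂ := fun x : N => TangentSpace 𝓘(ℝ, E) x)
    ((S.contMDiff_φ x).mdifferentiableAt (by simp)) hY

end FramedMetricFStructure


theorem norm_starProjection_of_angleWith {x : N} (w : TangentSpace 𝓘(ℝ, E) x)
    (K : Submodule ℝ (TangentSpace 𝓘(ℝ, E) x)) :
    ‖K.starProjection w‖ = Real.cos (angleWith w K) * ‖w‖ := by
  by_cases h0 : K.starProjection w = 0
  -- The angle with the zero vector is π/2 by convention, so its cosine vanishes as needed.
  · simp [angleWith, h0]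
  have h1 : (inner ℝ w (K.starProjection w) : ℝ) = ‖K.starProjection w‖ ^ 2 := by
    have h := K.starProjection_inner_eq_zero w _ (K.starProjection_apply_mem w)
    rw [inner_sub_left, real_inner_self_eq_norm_sq] at h
    linarith
  have h2 := InnerProductGeometry.cos_angle_mul_norm_mul_norm w (K.starProjection w)
  rw [h1, sq, ← mul_assoc] at h2
  exact (mul_right_cancel₀ (norm_ne_zero_iff.2 h0) h2).symm

theorem mdifferentiableAt_inner {x : N} {Y Z : ∀ z : N, TangentSpace 𝓘(ℝ, E) z}
    (hY : MDifferentiableAt 𝓘(ℝ, E) (𝓘(ℝ, E).prod 𝓘(ℝ, E))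
      (fun z : N => TotalSpace.mk' E (E := fun x : N => TangentSpace 𝓘(ℝ, E) x) z (Y z)) x)
    (hZ : MDifferentiableAt 𝓘(ℝ, E) (𝓘(ℝ, E).prod 𝓘(ℝ, E))
      (fun z : N => TotalSpace.mk' E (E := fun x : N => TangentSpace 𝓘(ℝ, E) x) z (Z z)) x) :
    MDifferentiableAt 𝓘(ℝ, E) 𝓘(ℝ, ℝ) (fun z : N => (inner ℝ (Y z) (Z z) : ℝ)) x :=
  MDifferentiableAt.inner_bundle (F := E) (E := fun x : N => TangentSpace 𝓘(ℝ, E) x) hY hZ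

/-- The derivative of an ambient function in a direction tangent to a parametrized submanifold. -/
theorem mvfderiv_apply_mfderiv {V : Type*} [NormedAddCommGroup V] [NormedSpace ℝ V]
    {j : V → N} {u₀ : V} {G : N → ℝ} {g : V → ℝ}
    (hG : MDifferentiableAt 𝓘(ℝ, E) 𝓘(ℝ, ℝ) G (j u₀))
    (hj : MDifferentiableAt 𝓘(ℝ, V) 𝓘(ℝ, E) j u₀)
    (hg : G ∘ j =ᶠ[𝓝 u₀] g) (a : V) :
    DifferentiableAt ℝ g u₀ ∧
    mvfderiv 𝓘(ℝ, E) G (j u₀) (mfderiv 𝓘(ℝ, V) 𝓘(ℝ, E) j u₀ a) = fderiv ℝ g u₀ a := by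
  have h1 := mvfderiv_comp_apply u₀ hG hj a
  have h2 : DifferentiableAt ℝ (G ∘ j) u₀ := (hG.comp u₀ hj).differentiableAt
  refine ⟨h2.congr_of_eventuallyEq hg.symm, ?_⟩
  rw [← h1, ← hg.fderiv_eq, mvfderiv]
  simp only [mfderiv_eq_fderiv]
  rfl

end Pointwise

/-! ### The warping identity in a local parametrization. -/

section Parametrized

variable {E : Type*} [NormedAddCommGroup E] [NormedSpace ℝ E] [FiniteDimensional ℝ E]
  {N : Type*} [TopologicalSpace N] [ChartedSpace E N] [IsManifold 𝓘(ℝ, E) ∞ N]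
  [RiemannianBundle (fun x : N => TangentSpace 𝓘(ℝ, E) x)]
  [IsContMDiffRiemannianBundle 𝓘(ℝ, E) ∞ E (fun x : N => TangentSpace 𝓘(ℝ, E) x)]
  {E₁ : Type*} [NormedAddCommGroup E₁] [NormedSpace ℝ E₁] [FiniteDimensional ℝ E₁]
  {E₂ : Type*} [NormedAddCommGroup E₂] [NormedSpace ℝ E₂] [FiniteDimensional ℝ E₂]

/-- The differential of a map from a vector space to `N`, evaluated on a fixed vector `w`. -/
noncomputable def coordField {V : Type*} [NormedAddCommGroup V] [NormedSpace ℝ V] (j : V → N) (w u : V) :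
    TangentSpace 𝓘(ℝ, E) (j u) :=
  mfderiv 𝓘(ℝ, V) 𝓘(ℝ, E) j u w

theorem coordField_sub {V : Type*} [NormedAddCommGroup V] [NormedSpace ℝ V] (j : V → N)
    (w w' u : V) : coordField (E := E) j (w - w') u = coordField j w u - coordField j w' u :=
  (mfderiv 𝓘(ℝ, V) 𝓘(ℝ, E) j u).map_sub w w'

theorem coordField_add {V : Type*} [NormedAddCommGroup V] [NormedSpace ℝ V] (j : V → N)
    (w w' u : V) : coordField (E := E) j (w + w') u = coordField j w u + coordField j w' u :=
  (mfderiv 𝓘(ℝ, V) 𝓘(ℝ, E) j u).map_add w w'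

theorem coordField_smul {V : Type*} [NormedAddCommGroup V] [NormedSpace ℝ V] (j : V → N)
    (c : ℝ) (w u : V) : coordField (E := E) j (c • w) u = c • coordField j w u :=
  (mfderiv 𝓘(ℝ, V) 𝓘(ℝ, E) j u).map_smul c w

/-- The logarithmic derivative `μ` of the warping function in a direction `Z` of the
anti-invariant factor equals `∑ k, η k Z`, if the slant factor is not anti-invariant. -/
theorem warping_eq_sum_η {s : ℕ} (S : FramedMetricFStructure E N s)
    (D : CovariantDerivative 𝓘(ℝ, E) E (fun x : N => TangentSpace 𝓘(ℝ, E) x))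
    (hD : IsLeviCivita D) (hS : IsNearlyKenmotsu S D)
    {j : E₁ × E₂ → N} {u₀ : E₁ × E₂}
    (hj : ContMDiffAt 𝓘(ℝ, E₁ × E₂) 𝓘(ℝ, E) ∞ j u₀)
    (hinj : Function.Injective (mfderiv 𝓘(ℝ, E₁ × E₂) 𝓘(ℝ, E) j u₀))
    (horth : ∀ᶠ u in 𝓝 u₀, ∀ a b,
      (inner ℝ (coordField (E := E) j (a, 0) u) (coordField j (0, b) u) : ℝ) = 0)
    (hanti : ∀ᶠ u in 𝓝 u₀, ∀ a w,
      (inner ℝ (S.φ (j u) (coordField j (a, 0) u)) (coordField j w u) : ℝ) = 0)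
    (hη : ∀ k b, S.η k (j u₀) (coordField j (0, b) u₀) = 0)
    (hgeod : ∀ (w : E₁ × E₂) (Y : ∀ z : N, TangentSpace 𝓘(ℝ, E) z),
      MDifferentiableAt 𝓘(ℝ, E) (𝓘(ℝ, E).prod 𝓘(ℝ, E))
        (fun z : N => TotalSpace.mk' E (E := fun x : N => TangentSpace 𝓘(ℝ, E) x) z (Y z))
        (j u₀) →
      (∀ᶠ u in 𝓝 u₀, ∃ w', Y (j u) = coordField j w' u) →
      ∃ w', D Y (j u₀) (coordField j w u₀) = coordField j w' u₀)
    {Z : E₁} {μ : ℝ}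
    (hμ : ∀ b b', fderiv ℝ (fun a => (inner ℝ (coordField (E := E) j (0, b) (a, u₀.2))
      (coordField j (0, b') (a, u₀.2)) : ℝ)) u₀.1 Z =
        2 * μ * inner ℝ (coordField (E := E) j (0, b) u₀) (coordField j (0, b') u₀))
    {c : ℝ} {b b' : E₂}
    (hslant : ∀ᶠ u in 𝓝 u₀,
      (inner ℝ (S.φ (j u) (coordField j (0, b) u)) (coordField j (0, b') u) : ℝ) ^ 2 ≤
      c * (inner ℝ (coordField (E := E) j (0, b) u) (coordField j (0, b) u) *
        inner ℝ (coordField (E := E) j (0, b') u) (coordField j (0, b') u)))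
    (hslant₀ :
      (inner ℝ (S.φ (j u₀) (coordField j (0, b) u₀)) (coordField j (0, b') u₀) : ℝ) ^ 2 =
      c * (inner ℝ (coordField (E := E) j (0, b) u₀) (coordField j (0, b) u₀) *
        inner ℝ (coordField (E := E) j (0, b') u₀) (coordField j (0, b') u₀)))
    (hne : (inner ℝ (S.φ (j u₀) (coordField j (0, b) u₀)) (coordField j (0, b') u₀) : ℝ) ≠ 0) :
    μ = ∑ k, S.η k (j u₀) (coordField j (Z, 0) u₀) := by
  obtain ⟨Y, hYd, hYj, hYb⟩ := exists_extension_coordinate_fields hj hinj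
  have hjd : MDifferentiableAt 𝓘(ℝ, E₁ × E₂) 𝓘(ℝ, E) j u₀ := hj.mdifferentiableAt (by simp)
  have hYj : ∀ᶠ u in 𝓝 u₀, ∀ w, Y w (j u) = coordField j w u := hYj
  have hY₀ : ∀ w, Y w (j u₀) = coordField j w u₀ := hYj.self_of_nhds
  set T : E₁ × E₂ → TangentSpace 𝓘(ℝ, E) (j u₀) := fun w => coordField j w u₀ with hT
  -- Zero torsion and commuting fields make the covariant derivatives symmetric.
  have hcomm : ∀ w w', D (Y w) (j u₀) (T w') = D (Y w') (j u₀) (T w) := by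
    intro w w'
    have h := (D.torsion_eq_zero_iff.1 hD.torsion) (hYd w) (hYd w')
    rw [hYb, sub_eq_zero, hY₀, hY₀] at h
    exact h.symm
  have hφd : ∀ w, _ := fun w => S.mdifferentiableAt_φ (hYd w)
  -- derivatives of inner products of the extended fields
  have hg : ∀ w w' a, DifferentiableAt ℝ (fun u => (inner ℝ (coordField (E := E) j w u)
      (coordField j w' u) : ℝ)) u₀ ∧
      fderiv ℝ (fun u => (inner ℝ (coordField (E := E) j w u) (coordField j w' u) : ℝ)) u₀ a =
      inner ℝ (D (Y w) (j u₀) (T a)) (T w') + inner ℝ (T w) (D (Y w') (j u₀) (T a)) := by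
    intro w w' a
    have h1 := mvfderiv_apply_mfderiv (E := E) (mdifferentiableAt_inner (hYd w) (hYd w')) hjd
      (g := fun u => (inner ℝ (coordField (E := E) j w u) (coordField j w' u) : ℝ)) (by
        filter_upwards [hYj] with u hu
        simp only [Function.comp_apply, hu]) a
    refine ⟨h1.1, h1.2.symm.trans ?_⟩
    rw [hD.metric _ _ _ _ (hYd w) (hYd w'), hY₀, hY₀]
    rfl
  have hω : ∀ w w' a, DifferentiableAt ℝ (fun u => (inner ℝ (S.φ (j u) (coordField (E := E) j w u))
      (coordField j w' u) : ℝ)) u₀ ∧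
      fderiv ℝ (fun u => (inner ℝ (S.φ (j u) (coordField (E := E) j w u))
        (coordField j w' u) : ℝ)) u₀ a =
      inner ℝ (D (fun z => S.φ z (Y w z)) (j u₀) (T a)) (T w') +
        inner ℝ (S.φ (j u₀) (T w)) (D (Y w') (j u₀) (T a)) := by
    intro w w' a
    have h1 := mvfderiv_apply_mfderiv (E := E) (mdifferentiableAt_inner (hφd w) (hYd w')) hjd
      (g := fun u => (inner ℝ (S.φ (j u) (coordField (E := E) j w u)) (coordField j w' u) : ℝ)) (by
        filter_upwards [hYj] with u hu
        simp only [Function.comp_apply, hu]) a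
    refine ⟨h1.1, h1.2.symm.trans ?_⟩
    rw [hD.metric _ _ _ _ (hφd w) (hYd w'), hY₀, hY₀]
    rfl
  have htan : ∀ w a, ∃ w', D (Y w) (j u₀) (T a) = T w' := fun w a =>
    hgeod a (Y w) (hYd w) (hYj.mono fun u hu => ⟨w, hu w⟩)
  have horth₀ : ∀ a b, (inner ℝ (T (a, 0)) (T (0, b)) : ℝ) = 0 := horth.self_of_nhds
  have hanti₀ : ∀ a w, (inner ℝ (S.φ (j u₀) (T (a, 0))) (T w) : ℝ) = 0 := hanti.self_of_nhds
  have hμ₀ : ∀ b b', fderiv ℝ (fun u => (inner ℝ (coordField (E := E) j (0, b) u)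
      (coordField j (0, b') u) : ℝ)) u₀ (Z, 0) = 2 * μ * inner ℝ (T (0, b)) (T (0, b')) := by
    intro b b'
    refine Eq.trans ?_ (hμ b b')
    have h1 : HasFDerivAt (fun a : E₁ => (a, u₀.2)) (ContinuousLinearMap.inl ℝ E₁ E₂) u₀.1 :=
      hasFDerivAt_prodMk_left u₀.1 u₀.2
    have h2 := HasFDerivAt.comp u₀.1 (hg (0, b) (0, b') 0).1.hasFDerivAt h1
    exact congr($(h2.fderiv) Z).symm
  have hfderiv_zero : ∀ (b : E₂) (a : E₁ × E₂), fderiv ℝ (fun u => (inner ℝ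
      (coordField (E := E) j (Z, 0) u) (coordField j (0, b) u) : ℝ)) u₀ a = 0 := by
    intro b a
    rw [Filter.EventuallyEq.fderiv_eq (f := fun _ => (0 : ℝ))]
    · simp
    · filter_upwards [horth] with u hu using hu Z b
  -- the mixed covariant derivative
  have hmix : ∀ b b', (inner ℝ (D (Y (Z, 0)) (j u₀) (T (0, b))) (T (0, b')) : ℝ) =
      μ * inner ℝ (T (0, b)) (T (0, b')) := by
    intro b b'
    have h1 := (hg (0, b) (0, b') (Z, 0)).2
    have h2 := (hg (Z, 0) (0, b) (0, b')).2
    have h3 := (hg (Z, 0) (0, b') (0, b)).2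
    rw [hμ₀] at h1
    rw [hfderiv_zero] at h2 h3
    -- `h1` gives the sum of the pairings of ∇_b Z with b' and of ∇_{b'} Z with b. By `h2`, `h3`
    -- both equal -g(Z, ∇_b b'), so each is half of 2μ g(b, b').
    rw [hcomm (0, b) (Z, 0), hcomm (0, b') (Z, 0)] at h1
    rw [hcomm (0, b) (0, b')] at h2
    have e1 := real_inner_comm (T (0, b)) (D (Y (Z, 0)) (j u₀) (T (0, b')))
    linarith
  have hmix' : ∀ b (v : TangentSpace 𝓘(ℝ, E) (j u₀)),
      (∀ a, (inner ℝ v (T (a, 0)) : ℝ) = 0) →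
      (inner ℝ v (D (Y (Z, 0)) (j u₀) (T (0, b))) : ℝ) = μ * inner ℝ v (T (0, b)) := by
    intro b v hv
    obtain ⟨⟨w₁, w₂⟩, hw⟩ := htan (Z, 0) (0, b)
    have hsplit : T (w₁, w₂) = T (w₁, 0) + T (0, w₂) := by
      simp only [hT, ← coordField_add, Prod.mk_add_mk, add_zero, zero_add]
    have hdiff : T (0, w₂ - μ • b) = T (0, w₂) - μ • T (0, b) := by
      simp only [hT, ← coordField_smul, ← coordField_sub, Prod.smul_mk, Prod.mk_sub_mk, smul_zero,
        sub_zero]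
    -- The `D_θ`-component of the tangent vector ∇_b Z is μb: by `hmix` their difference is
    -- orthogonal to itself.
    have hzero : T (0, w₂ - μ • b) = 0 := by
      rw [← inner_self_eq_zero (𝕜 := ℝ)]
      have h := hmix b (w₂ - μ • b)
      rw [hw, hsplit, inner_add_left, horth₀, zero_add] at h
      nth_rewrite 1 [hdiff]
      rw [inner_sub_left, inner_smul_left, h]
      simp
    rw [hw, hsplit, inner_add_right, hv, zero_add, ← inner_smul_right]
    rw [hdiff, sub_eq_zero] at hzero
    rw [hzero]
  have hskew := S.inner_φ_left (j u₀)
  have hφorth : ∀ (b : E₂) (a : E₁), (inner ℝ (S.φ (j u₀) (T (0, b))) (T (a, 0)) : ℝ) = 0 := by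
    intro b a
    rw [hskew, real_inner_comm, hanti₀, neg_zero]
  -- the derivative of the fundamental two-form
  have hωZ : fderiv ℝ (fun u => (inner ℝ (S.φ (j u) (coordField (E := E) j (0, b) u))
      (coordField j (0, b') u) : ℝ)) u₀ (Z, 0) =
      (3 * μ - ∑ k, S.η k (j u₀) (T (Z, 0))) *
        inner ℝ (S.φ (j u₀) (T (0, b))) (T (0, b')) := by
    have hK := congrArg (fun v => (inner ℝ v (T (0, b')) : ℝ))
      (hS (j u₀) (Y (0, b)) (Y (Z, 0)) (hYd _) (hYd _))
    simp only [covDerivEnd, hY₀] at hK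
    -- g(φZ, b') vanishes along the submanifold and φZ is normal to ∇_b b', so g(∇_b(φZ), b') = 0.
    have h1 := (hω (Z, 0) (0, b') (0, b)).2
    rw [Filter.EventuallyEq.fderiv_eq (f := fun _ => (0 : ℝ))
      (by filter_upwards [hanti] with u hu using hu Z _)] at h1
    obtain ⟨w, hw⟩ := htan (0, b') (0, b)
    rw [hw, hanti₀] at h1
    have h2 := (hω (0, b) (0, b') (Z, 0)).2
    rw [hcomm, hmix' b' _ (hφorth b)] at h2
    -- Skew-symmetry moves φ onto b', and φb' is orthogonal to `D^⊥`, so only the component μb of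
    -- ∇_b Z contributes.
    have h3 : (inner ℝ (S.φ (j u₀) (D (Y (Z, 0)) (j u₀) (T (0, b)))) (T (0, b')) : ℝ) =
        μ * inner ℝ (S.φ (j u₀) (T (0, b))) (T (0, b')) := by
      rw [hskew, real_inner_comm, hmix' b _ (hφorth b'), hskew (T (0, b)),
        real_inner_comm (T (0, b))]
      ring
    rw [h2]
    rw [inner_add_left, inner_sub_left, inner_sub_left, hcomm (0, b) (Z, 0), inner_neg_left,
      sum_inner] at hK
    simp only [inner_add_left, inner_smul_left, hη, hT] at hK
    simp only [hT] at h1 h3 ⊢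
    simp only [map_zero, zero_mul, zero_add, conj_trivial, ← Finset.sum_mul] at hK h1
    simp only [fderiv_fun_const, Pi.zero_apply, _root_.zero_apply, add_zero] at h1
    linarith
  -- the extremum
  have hd1 := (hω (0, b) (0, b') 0).1
  have hd2 := (hg (0, b) (0, b) 0).1
  have hd3 := (hg (0, b') (0, b') 0).1
  have hmax : IsLocalMax (fun u => (inner ℝ (S.φ (j u) (coordField j (0, b) u))
      (coordField j (0, b') u) : ℝ) ^ 2 -
      c * (inner ℝ (coordField (E := E) j (0, b) u) (coordField j (0, b) u) *
        inner ℝ (coordField (E := E) j (0, b') u) (coordField j (0, b') u))) u₀ := by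
    filter_upwards [hslant] with u hu
    rw [hslant₀, sub_self]
    exact sub_nonpos.2 hu
  have hF := (hd1.hasFDerivAt.pow 2).sub ((hd2.hasFDerivAt.mul hd3.hasFDerivAt).const_mul c)
  have h0 := congr($(hmax.hasFDerivAt_eq_zero hF) (Z, 0))
  simp only [sub_apply, smul_apply,
    add_apply, hωZ, hμ₀, smul_eq_mul, _root_.zero_apply] at h0
  set t : ℝ := inner ℝ (S.φ (j u₀) (coordField j (0, b) u₀)) (coordField j (0, b') u₀)
  have h5 : (μ - ∑ k, S.η k (j u₀) (T (Z, 0))) * t ^ 2 = 0 := by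
    simp only [hT] at h0 ⊢
    -- Half of `h0` reads (3μ - Σ η)t² = 2μc|b|²|b'|²; the equality case `hslant₀` turns the right
    -- side into 2μt².
    rw [two_nsmul, Nat.add_one_sub_one, pow_one] at h0
    linear_combination (1 / 2) * h0 - 2 * μ * hslant₀
  exact sub_eq_zero.1 ((mul_eq_zero.1 h5).resolve_right (pow_ne_zero 2 hne))

end Parametrized

/-! ### Local parametrizations of the factors. -/

section LocalParam

variable {F : Type*} [NormedAddCommGroup F] [NormedSpace ℝ F] [FiniteDimensional ℝ F]
  {M : Type*} [TopologicalSpace M] [ChartedSpace F M] [IsManifold 𝓘(ℝ, F) ∞ M]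

/-- Every point of a manifold lies in the image of a smooth local parametrization. -/
theorem exists_local_parametrization (p : M) : ∃ (e : F → M) (a₀ : F), e a₀ = p ∧
    (∀ᶠ a in 𝓝 a₀, ContMDiffAt 𝓘(ℝ, F) 𝓘(ℝ, F) ∞ e a ∧
      (mfderiv 𝓘(ℝ, F) 𝓘(ℝ, F) e a).IsInvertible) ∧
    𝓝 (e a₀) ≤ Filter.map e (𝓝 a₀) := by
  refine ⟨(extChartAt 𝓘(ℝ, F) p).symm, extChartAt 𝓘(ℝ, F) p p, extChartAt_to_inv p, ?_, ?_⟩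
  · filter_upwards [extChartAt_target_mem_nhds (I := 𝓘(ℝ, F)) p] with a ha
    constructor
    · exact (contMDiffOn_extChartAt_symm p).contMDiffAt
        ((isOpen_extChartAt_target p).mem_nhds ha)
    · have := isInvertible_mfderivWithin_extChartAt_symm ha
      rwa [modelWithCornersSelf_coe, Set.range_id, mfderivWithin_univ] at this
  · have := map_extChartAt_symm_nhdsWithin_range (I := 𝓘(ℝ, F)) p
    rw [modelWithCornersSelf_coe, Set.range_id, nhdsWithin_univ] at this
    rw [extChartAt_to_inv, this]

end LocalParam

/-! ### Differentials of maps on a product. -/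

section Product

variable {E : Type*} [NormedAddCommGroup E] [NormedSpace ℝ E] [FiniteDimensional ℝ E]
  {N : Type*} [TopologicalSpace N] [ChartedSpace E N] [IsManifold 𝓘(ℝ, E) ∞ N]
  {E₁ : Type*} [NormedAddCommGroup E₁] [NormedSpace ℝ E₁] [FiniteDimensional ℝ E₁]
  {M₁ : Type*} [TopologicalSpace M₁] [ChartedSpace E₁ M₁] [IsManifold 𝓘(ℝ, E₁) ∞ M₁]
  {E₂ : Type*} [NormedAddCommGroup E₂] [NormedSpace ℝ E₂] [FiniteDimensional ℝ E₂]
  {M₂ : Type*} [TopologicalSpace M₂] [ChartedSpace E₂ M₂] [IsManifold 𝓘(ℝ, E₂) ∞ M₂]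

/-- The differential of a map on a product, as a function of the two components of a tangent
vector. -/
noncomputable def prodDeriv (ι : M₁ × M₂ → N) (x : M₁ × M₂) (a : TangentSpace 𝓘(ℝ, E₁) x.1)
    (b : TangentSpace 𝓘(ℝ, E₂) x.2) : TangentSpace 𝓘(ℝ, E) (ι x) :=
  mfderiv (𝓘(ℝ, E₁).prod 𝓘(ℝ, E₂)) 𝓘(ℝ, E) ι x (a, b)

theorem mfderiv_left {ι : M₁ × M₂ → N} {x : M₁ × M₂}
    (hι : MDifferentiableAt (𝓘(ℝ, E₁).prod 𝓘(ℝ, E₂)) 𝓘(ℝ, E) ι x)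
    (a : TangentSpace 𝓘(ℝ, E₁) x.1) :
    mfderiv 𝓘(ℝ, E₁) 𝓘(ℝ, E) (fun p : M₁ => ι (p, x.2)) x.1 a = prodDeriv (E₂ := E₂) ι x a 0 := by
  have h1 : MDifferentiableAt 𝓘(ℝ, E₁) (𝓘(ℝ, E₁).prod 𝓘(ℝ, E₂))
      (fun p : M₁ => (p, x.2)) x.1 := 
    mdifferentiableAt_id.prodMk (mdifferentiableAt_const (I' := 𝓘(ℝ, E₂)))
  have h2 := mfderiv_comp_apply x.1 (f := fun p : M₁ => (p, x.2)) (g := ι) hι h1 a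
  rw [mfderiv_prod_left] at h2
  exact h2

theorem mfderiv_right {ι : M₁ × M₂ → N} {x : M₁ × M₂}
    (hι : MDifferentiableAt (𝓘(ℝ, E₁).prod 𝓘(ℝ, E₂)) 𝓘(ℝ, E) ι x)
    (b : TangentSpace 𝓘(ℝ, E₂) x.2) :
    mfderiv 𝓘(ℝ, E₂) 𝓘(ℝ, E) (fun q : M₂ => ι (x.1, q)) x.2 b = prodDeriv (E₁ := E₁) ι x 0 b := by
  have h1 : MDifferentiableAt 𝓘(ℝ, E₂) (𝓘(ℝ, E₁).prod 𝓘(ℝ, E₂))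
      (fun q : M₂ => (x.1, q)) x.2 := 
    (mdifferentiableAt_const (I' := 𝓘(ℝ, E₁))).prodMk mdifferentiableAt_id
  have h2 := mfderiv_comp_apply x.2 (f := fun q : M₂ => (x.1, q)) (g := ι) hι h1 b
  rw [mfderiv_prod_right] at h2
  exact h2

theorem coordField_prodMap {ι : M₁ × M₂ → N} {e₁ : E₁ → M₁} {e₂ : E₂ → M₂} {u : E₁ × E₂}
    (hι : MDifferentiableAt (𝓘(ℝ, E₁).prod 𝓘(ℝ, E₂)) 𝓘(ℝ, E) ι (e₁ u.1, e₂ u.2))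
    (he₁ : MDifferentiableAt 𝓘(ℝ, E₁) 𝓘(ℝ, E₁) e₁ u.1)
    (he₂ : MDifferentiableAt 𝓘(ℝ, E₂) 𝓘(ℝ, E₂) e₂ u.2) (a : E₁) (b : E₂) :
    coordField (E := E) (fun u : E₁ × E₂ => ι (e₁ u.1, e₂ u.2)) (a, b) u =
      prodDeriv ι (e₁ u.1, e₂ u.2) (mfderiv 𝓘(ℝ, E₁) 𝓘(ℝ, E₁) e₁ u.1 a)
        (mfderiv 𝓘(ℝ, E₂) 𝓘(ℝ, E₂) e₂ u.2 b) := by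
  have hf : MDifferentiableAt 𝓘(ℝ, E₁ × E₂) 𝓘(ℝ, E₁) (Prod.fst : E₁ × E₂ → E₁) u :=
    differentiableAt_fst.mdifferentiableAt
  have hs : MDifferentiableAt 𝓘(ℝ, E₁ × E₂) 𝓘(ℝ, E₂) (Prod.snd : E₁ × E₂ → E₂) u :=
    differentiableAt_snd.mdifferentiableAt
  have h1 : MDifferentiableAt 𝓘(ℝ, E₁ × E₂) 𝓘(ℝ, E₁) (e₁ ∘ Prod.fst) u := he₁.comp u hf
  have h2 : MDifferentiableAt 𝓘(ℝ, E₁ × E₂) 𝓘(ℝ, E₂) (e₂ ∘ Prod.snd) u := he₂.comp u hs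
  have h3 := mfderiv_comp_apply u (f := fun u : E₁ × E₂ => ((e₁ ∘ Prod.fst) u, (e₂ ∘ Prod.snd) u))
    (g := ι) hι (h1.prodMk h2) (a, b)
  rw [h1.mfderiv_prod h2, mfderiv_comp u he₁ hf, mfderiv_comp u he₂ hs,
    mfderiv_eq_fderiv, mfderiv_eq_fderiv, fderiv_fst, fderiv_snd] at h3
  exact h3

end Product

/-! ### Consequences of the warped metric and the slant condition. -/

section Submanifold

variable {E : Type*} [NormedAddCommGroup E] [NormedSpace ℝ E] [FiniteDimensional ℝ E]
  {N : Type*} [TopologicalSpace N] [ChartedSpace E N] [IsManifold 𝓘(ℝ, E) ∞ N]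
  [RiemannianBundle (fun x : N => TangentSpace 𝓘(ℝ, E) x)]
  [IsContMDiffRiemannianBundle 𝓘(ℝ, E) ∞ E (fun x : N => TangentSpace 𝓘(ℝ, E) x)]
  {E₁ : Type*} [NormedAddCommGroup E₁] [NormedSpace ℝ E₁] [FiniteDimensional ℝ E₁]
  {M₁ : Type*} [TopologicalSpace M₁] [ChartedSpace E₁ M₁] [IsManifold 𝓘(ℝ, E₁) ∞ M₁]
  [RiemannianBundle (fun p : M₁ => TangentSpace 𝓘(ℝ, E₁) p)]
  [IsContMDiffRiemannianBundle 𝓘(ℝ, E₁) ∞ E₁ (fun p : M₁ => TangentSpace 𝓘(ℝ, E₁) p)]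
  {E₂ : Type*} [NormedAddCommGroup E₂] [NormedSpace ℝ E₂] [FiniteDimensional ℝ E₂]
  {M₂ : Type*} [TopologicalSpace M₂] [ChartedSpace E₂ M₂] [IsManifold 𝓘(ℝ, E₂) ∞ M₂]
  [RiemannianBundle (fun q : M₂ => TangentSpace 𝓘(ℝ, E₂) q)]
  [IsContMDiffRiemannianBundle 𝓘(ℝ, E₂) ∞ E₂ (fun q : M₂ => TangentSpace 𝓘(ℝ, E₂) q)]
  {f : M₁ → ℝ} {ι : M₁ × M₂ → N} {x : M₁ × M₂}

theorem prodDeriv_add_prodDeriv (a a' : TangentSpace 𝓘(ℝ, E₁) x.1)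
    (b b' : TangentSpace 𝓘(ℝ, E₂) x.2) :
    prodDeriv (E := E) ι x a b + prodDeriv ι x a' b' = prodDeriv ι x (a + a') (b + b') :=
  ((mfderiv (𝓘(ℝ, E₁).prod 𝓘(ℝ, E₂)) 𝓘(ℝ, E) ι x).map_add (a, b) (a', b')).symm

theorem prodDeriv_mem_tangent (a : TangentSpace 𝓘(ℝ, E₁) x.1) (b : TangentSpace 𝓘(ℝ, E₂) x.2) :
    prodDeriv (E := E) ι x a b ∈ tangent (𝓘(ℝ, E₁).prod 𝓘(ℝ, E₂)) ι x :=
  ⟨(a, b), rfl⟩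

theorem mem_tangent_iff {v : TangentSpace 𝓘(ℝ, E) (ι x)} :
    v ∈ tangent (𝓘(ℝ, E₁).prod 𝓘(ℝ, E₂)) ι x ↔
      ∃ (a : TangentSpace 𝓘(ℝ, E₁) x.1) (b : TangentSpace 𝓘(ℝ, E₂) x.2), prodDeriv ι x a b = v :=
  ⟨fun ⟨w, hw⟩ => ⟨w.1, w.2, hw⟩, fun ⟨a, b, h⟩ => ⟨(a, b), h⟩⟩

theorem mem_firstDistribution_iff
    (hι : MDifferentiableAt (𝓘(ℝ, E₁).prod 𝓘(ℝ, E₂)) 𝓘(ℝ, E) ι x)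
    {v : TangentSpace 𝓘(ℝ, E) (ι x)} :
    v ∈ firstDistribution (E₁ := E₁) ι x ↔
      ∃ a : TangentSpace 𝓘(ℝ, E₁) x.1, prodDeriv (E₂ := E₂) ι x a 0 = v :=
  exists_congr fun a => by rw [← mfderiv_left hι]; rfl

theorem mem_secondDistribution_iff
    (hι : MDifferentiableAt (𝓘(ℝ, E₁).prod 𝓘(ℝ, E₂)) 𝓘(ℝ, E) ι x)
    {v : TangentSpace 𝓘(ℝ, E) (ι x)} :
    v ∈ secondDistribution (E₂ := E₂) ι x ↔
      ∃ b : TangentSpace 𝓘(ℝ, E₂) x.2, prodDeriv (E₁ := E₁) ι x 0 b = v :=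
  exists_congr fun b => by rw [← mfderiv_right hι]; rfl

theorem IsWarpedProductIsometric.inner_prodDeriv
    (hw : IsWarpedProductIsometric (E₁ := E₁) (E₂ := E₂) (E := E) f ι)
    (a a' : TangentSpace 𝓘(ℝ, E₁) x.1) (b b' : TangentSpace 𝓘(ℝ, E₂) x.2) :
    (inner ℝ (prodDeriv (E := E) ι x a b) (prodDeriv ι x a' b') : ℝ) =
      inner ℝ a a' + f x.1 ^ 2 * inner ℝ b b' := by
  have h := hw x (a, b) (a', b')
  rw [mfderiv_fst, mfderiv_snd] at h
  exact h

/-- The warped metric is definite because f > 0; this is the source of injectivity of the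
differential. -/
theorem IsWarpedProductIsometric.prodDeriv_eq_zero
    (hw : IsWarpedProductIsometric (E₁ := E₁) (E₂ := E₂) (E := E) f ι) (hf : 0 < f x.1)
    {a : TangentSpace 𝓘(ℝ, E₁) x.1} {b : TangentSpace 𝓘(ℝ, E₂) x.2}
    (h : prodDeriv (E := E) ι x a b = 0) : a = 0 ∧ b = 0 := by
  have h1 := hw.inner_prodDeriv a a b b
  rw [h, inner_zero_left] at h1
  have ha : 0 ≤ (inner ℝ a a : ℝ) := real_inner_self_nonneg
  have hb : 0 ≤ (inner ℝ b b : ℝ) := real_inner_self_nonneg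
  have hb' := mul_nonneg (sq_nonneg (f x.1)) hb
  refine ⟨inner_self_eq_zero (𝕜 := ℝ).1 (by linarith), inner_self_eq_zero (𝕜 := ℝ).1 ?_⟩
  exact (mul_eq_zero.1 (by linarith : f x.1 ^ 2 * (inner ℝ b b : ℝ) = 0)).resolve_left
    (pow_ne_zero 2 hf.ne')

variable {s : ℕ} {S : FramedMetricFStructure E N s} {θ : ℝ}

theorem IsPseudoSlant.η_second (hslant : IsPseudoSlant (E₁ := E₁) (E₂ := E₂) S ι θ)
    (hw : IsWarpedProductIsometric (E₁ := E₁) (E₂ := E₂) (E := E) f ι)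
    (hι : MDifferentiableAt (𝓘(ℝ, E₁).prod 𝓘(ℝ, E₂)) 𝓘(ℝ, E) ι x) (k : Fin s)
    (b : TangentSpace 𝓘(ℝ, E₂) x.2) : S.η k (ι x) (prodDeriv (E₁ := E₁) ι x 0 b) = 0 := by
  obtain ⟨a, ha⟩ := (mem_firstDistribution_iff hι).1 (hslant.ξ_mem k x)
  rw [S.η_eq, ← ha, hw.inner_prodDeriv]
  simp

theorem IsPseudoSlant.inner_φ_first (hslant : IsPseudoSlant (E₁ := E₁) (E₂ := E₂) S ι θ)
    (hι : MDifferentiableAt (𝓘(ℝ, E₁).prod 𝓘(ℝ, E₂)) 𝓘(ℝ, E) ι x)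
    (a a' : TangentSpace 𝓘(ℝ, E₁) x.1) (b : TangentSpace 𝓘(ℝ, E₂) x.2) :
    (inner ℝ (S.φ (ι x) (prodDeriv ι x a (0 : TangentSpace 𝓘(ℝ, E₂) x.2)))
      (prodDeriv ι x a' b) : ℝ) = 0 :=
  (Submodule.mem_orthogonal' _ _).1
    (hslant.antiInvariant x _ ((mem_firstDistribution_iff hι).2 ⟨a, rfl⟩)) _
    (prodDeriv_mem_tangent a' b)

/-- The ξ_k are orthogonal to `D_θ`, so φ is isometric there and the angle condition gives the
length of the projection. -/
theorem IsPseudoSlant.norm_proj (hslant : IsPseudoSlant (E₁ := E₁) (E₂ := E₂) S ι θ)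
    (hw : IsWarpedProductIsometric (E₁ := E₁) (E₂ := E₂) (E := E) f ι)
    (hι : MDifferentiableAt (𝓘(ℝ, E₁).prod 𝓘(ℝ, E₂)) 𝓘(ℝ, E) ι x)
    (b : TangentSpace 𝓘(ℝ, E₂) x.2) :
    ‖(secondDistribution (E₂ := E₂) ι x).starProjection
      (S.φ (ι x) (prodDeriv (E₁ := E₁) ι x 0 b))‖ =
      Real.cos θ * ‖prodDeriv (E := E) (E₁ := E₁) ι x 0 b‖ := by
  by_cases h0 : prodDeriv (E := E) (E₁ := E₁) ι x 0 b = 0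
  · simp [h0]
  · rw [norm_starProjection_of_angleWith,
      hslant.slant x _ ((mem_secondDistribution_iff hι).2 ⟨b, rfl⟩) h0,
      S.norm_φ _ _ fun k => hslant.η_second hw hι k b]

theorem inner_prodDeriv_right_eq_starProjection (hι : MDifferentiableAt (𝓘(ℝ, E₁).prod 𝓘(ℝ, E₂)) 𝓘(ℝ, E) ι x)
    (v : TangentSpace 𝓘(ℝ, E) (ι x)) (b : TangentSpace 𝓘(ℝ, E₂) x.2) :
    (inner ℝ v (prodDeriv (E₁ := E₁) ι x 0 b) : ℝ) =
      inner ℝ ((secondDistribution (E₂ := E₂) ι x).starProjection v)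
        (prodDeriv (E₁ := E₁) ι x 0 b) := by
  have h := (secondDistribution (E₂ := E₂) ι x).starProjection_inner_eq_zero v _
    ((mem_secondDistribution_iff (E₁ := E₁) hι).2 ⟨b, rfl⟩)
  rw [inner_sub_left] at h
  linarith

/-- Cauchy–Schwarz applied to the `D_θ`-projection of φb, whose length is `cos θ` times that of b.
-/
theorem IsPseudoSlant.inner_φ_second_sq_le
    (hslant : IsPseudoSlant (E₁ := E₁) (E₂ := E₂) S ι θ)
    (hw : IsWarpedProductIsometric (E₁ := E₁) (E₂ := E₂) (E := E) f ι)
    (hι : MDifferentiableAt (𝓘(ℝ, E₁).prod 𝓘(ℝ, E₂)) 𝓘(ℝ, E) ι x)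
    (b b' : TangentSpace 𝓘(ℝ, E₂) x.2) :
    (inner ℝ (S.φ (ι x) (prodDeriv (E₁ := E₁) ι x 0 b)) (prodDeriv (E₁ := E₁) ι x 0 b') : ℝ) ^ 2 ≤
      Real.cos θ ^ 2 *
        (inner ℝ (prodDeriv (E := E) (E₁ := E₁) ι x 0 b) (prodDeriv (E₁ := E₁) ι x 0 b) *
          inner ℝ (prodDeriv (E := E) (E₁ := E₁) ι x 0 b') (prodDeriv (E₁ := E₁) ι x 0 b')) := by
  rw [inner_prodDeriv_right_eq_starProjection hι]
  have h := abs_real_inner_le_norm ((secondDistribution (E₂ := E₂) ι x).starProjection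
    (S.φ (ι x) (prodDeriv (E₁ := E₁) ι x 0 b))) (prodDeriv (E₁ := E₁) ι x 0 b')
  rw [hslant.norm_proj hw hι] at h
  have h2 := pow_le_pow_left₀ (abs_nonneg _) h 2
  rw [sq_abs] at h2
  rw [real_inner_self_eq_norm_sq, real_inner_self_eq_norm_sq]
  refine h2.trans_eq (by ring)

/-- Equality in Cauchy–Schwarz: b' represents the `D_θ`-projection of φb itself, which is nonzero
since `cos θ ≠ 0`. -/
theorem IsPseudoSlant.exists_inner_φ_second_sq_eq
    (hslant : IsPseudoSlant (E₁ := E₁) (E₂ := E₂) S ι θ)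
    (hw : IsWarpedProductIsometric (E₁ := E₁) (E₂ := E₂) (E := E) f ι) (hf : 0 < f x.1)
    (hι : MDifferentiableAt (𝓘(ℝ, E₁).prod 𝓘(ℝ, E₂)) 𝓘(ℝ, E) ι x) (hθ : Real.cos θ ≠ 0)
    {b : TangentSpace 𝓘(ℝ, E₂) x.2} (hb : b ≠ 0) :
    ∃ b' : TangentSpace 𝓘(ℝ, E₂) x.2,
    (inner ℝ (S.φ (ι x) (prodDeriv (E₁ := E₁) ι x 0 b)) (prodDeriv (E₁ := E₁) ι x 0 b') : ℝ) ^ 2 =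
      Real.cos θ ^ 2 *
        (inner ℝ (prodDeriv (E := E) (E₁ := E₁) ι x 0 b) (prodDeriv (E₁ := E₁) ι x 0 b) *
          inner ℝ (prodDeriv (E := E) (E₁ := E₁) ι x 0 b') (prodDeriv (E₁ := E₁) ι x 0 b')) ∧
    (inner ℝ (S.φ (ι x) (prodDeriv (E₁ := E₁) ι x 0 b))
      (prodDeriv (E₁ := E₁) ι x 0 b') : ℝ) ≠ 0 := by
  obtain ⟨b', hb'⟩ := (mem_secondDistribution_iff (E₁ := E₁) hι).1
    ((secondDistribution (E₂ := E₂) ι x).starProjection_apply_mem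
      (S.φ (ι x) (prodDeriv (E₁ := E₁) ι x 0 b)))
  have hn := hslant.norm_proj hw hι b
  refine ⟨b', ?_⟩
  rw [inner_prodDeriv_right_eq_starProjection hι, ← hb']
  rw [← hb'] at hn
  simp only [real_inner_self_eq_norm_sq]
  have h0 : ‖prodDeriv (E := E) (E₁ := E₁) ι x 0 b‖ ≠ 0 := fun h =>
    hb (hw.prodDeriv_eq_zero hf (norm_eq_zero.1 h)).2
  refine ⟨by rw [hn]; ring, ?_⟩
  rw [hn]
  exact pow_ne_zero 2 (mul_ne_zero hθ h0)

/-- If the slant angle is a right angle or the slant factor is zero-dimensional, the submanifold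
is anti-invariant. -/
theorem IsPseudoSlant.isAntiInvariant
    (hslant : IsPseudoSlant (E₁ := E₁) (E₂ := E₂) S ι θ)
    (hw : IsWarpedProductIsometric (E₁ := E₁) (E₂ := E₂) (E := E) f ι)
    (hι : MDifferentiable (𝓘(ℝ, E₁).prod 𝓘(ℝ, E₂)) 𝓘(ℝ, E) ι)
    (h : Real.cos θ = 0 ∨ Subsingleton E₂) :
    IsAntiInvariant (𝓘(ℝ, E₁).prod 𝓘(ℝ, E₂)) S ι := by
  intro x v hv
  have hzero : ∀ b b' : TangentSpace 𝓘(ℝ, E₂) x.2, (inner ℝ (S.φ (ι x)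
      (prodDeriv (E₁ := E₁) ι x 0 b)) (prodDeriv (E₁ := E₁) ι x 0 b') : ℝ) = 0 := by
    intro b b'
    rcases h with h | h
    · rw [inner_prodDeriv_right_eq_starProjection (hι x), norm_eq_zero.1 ((hslant.norm_proj hw (hι x) b).trans
        (by rw [h, zero_mul])), inner_zero_left]
    · have : b = 0 := Subsingleton.elim (α := E₂) b 0
      have h0 : prodDeriv (E := E) (E₁ := E₁) ι x 0 b = 0 := by
        rw [this]
        exact (mfderiv (𝓘(ℝ, E₁).prod 𝓘(ℝ, E₂)) 𝓘(ℝ, E) ι x).map_zero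
      rw [h0, map_zero, inner_zero_left]
  rw [Submodule.mem_orthogonal']
  intro w hw'
  obtain ⟨a, b, rfl⟩ := mem_tangent_iff.1 hv
  obtain ⟨a', b', rfl⟩ := mem_tangent_iff.1 hw'
  have e1 : prodDeriv (E := E) ι x a b =
      prodDeriv (E₂ := E₂) ι x a 0 + prodDeriv (E₁ := E₁) ι x 0 b := by
    rw [prodDeriv_add_prodDeriv, add_zero, zero_add]
  have e2 : prodDeriv (E := E) ι x a' b' =
      prodDeriv (E₂ := E₂) ι x a' 0 + prodDeriv (E₁ := E₁) ι x 0 b' := by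
    rw [prodDeriv_add_prodDeriv, add_zero, zero_add]
  -- Only the `D_θ`–`D_θ` block needs `hzero`; the pairing of φ(`D_θ`) with `D^⊥` reduces to
  -- anti-invariance by skew-symmetry.
  rw [e1, map_add, inner_add_left, e2, inner_add_right, inner_add_right,
    hslant.inner_φ_first (hι x), hslant.inner_φ_first (hι x), hzero, S.inner_φ_left,
    real_inner_comm, hslant.inner_φ_first (hι x)]
  simp

end Submanifold

/-! ### Totally geodesic immersions and logarithmic differentiation. -/

section Geodesic

variable {E : Type*} [NormedAddCommGroup E] [NormedSpace ℝ E] [FiniteDimensional ℝ E]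
  {N : Type*} [TopologicalSpace N] [ChartedSpace E N] [IsManifold 𝓘(ℝ, E) ∞ N]
  [RiemannianBundle (fun x : N => TangentSpace 𝓘(ℝ, E) x)]
  [IsContMDiffRiemannianBundle 𝓘(ℝ, E) ∞ E (fun x : N => TangentSpace 𝓘(ℝ, E) x)]
  {F : Type*} [NormedAddCommGroup F] [NormedSpace ℝ F]
  {H : Type*} [TopologicalSpace H] {I : ModelWithCorners ℝ F H}
  {M : Type*} [TopologicalSpace M] [ChartedSpace H M]

theorem IsTotallyGeodesic.covariantDerivative_mem
    {D : CovariantDerivative 𝓘(ℝ, E) E (fun x : N => TangentSpace 𝓘(ℝ, E) x)} {ι : M → N}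
    (h : IsTotallyGeodesic I D ι) {x : M} {u : TangentSpace 𝓘(ℝ, E) (ι x)}
    (hu : u ∈ tangent I ι x) {Y : ∀ z : N, TangentSpace 𝓘(ℝ, E) z}
    (hY : MDifferentiableAt 𝓘(ℝ, E) (𝓘(ℝ, E).prod 𝓘(ℝ, E))
      (fun z : N => TotalSpace.mk' E (E := fun x : N => TangentSpace 𝓘(ℝ, E) x) z (Y z)) (ι x))
    (hYt : IsTangentNear I ι x Y) : D Y (ι x) u ∈ tangent I ι x := by
  obtain ⟨w, rfl⟩ := hu
  have h1 : (tangent I ι x)ᗮ.starProjection (D Y (ι x) (mfderiv I 𝓘(ℝ, E) ι x w)) = 0 :=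
    h x w Y hY hYt
  rw [Submodule.starProjection_apply_eq_zero_iff, Submodule.orthogonal_orthogonal] at h1
  exact h1

/-- Logarithmic differentiation of a multiple of the square of a positive function. -/
theorem fderiv_sq_mul_const_eq_mvfderiv_log {V : Type*} [NormedAddCommGroup V] [NormedSpace ℝ V]
    {f : M → ℝ} {e : V → M} {a₀ : V} (hf : MDifferentiableAt I 𝓘(ℝ, ℝ) f (e a₀)) (hpos : 0 < f (e a₀))
    (he : MDifferentiableAt 𝓘(ℝ, V) I e a₀) (c : ℝ) (Z : V) :
    fderiv ℝ (fun a => f (e a) ^ 2 * c) a₀ Z =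
      2 * mvfderiv I (fun p => Real.log (f p)) (e a₀) (mfderiv 𝓘(ℝ, V) I e a₀ Z) *
        (f (e a₀) ^ 2 * c) := by
  have hF : DifferentiableAt ℝ (f ∘ e) a₀ := (hf.comp a₀ he).differentiableAt
  have hlog : MDifferentiableAt I 𝓘(ℝ, ℝ) (fun p => Real.log (f p)) (e a₀) :=
    MDifferentiableAt.comp (e a₀) (I' := 𝓘(ℝ, ℝ)) (g := Real.log)
      (Real.differentiableAt_log hpos.ne').mdifferentiableAt hf
  have h1 := mvfderiv_comp_apply a₀ hlog he Z
  have h2 : mvfderiv 𝓘(ℝ, V) ((fun p => Real.log (f p)) ∘ e) a₀ Z =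
      (f (e a₀))⁻¹ * fderiv ℝ (f ∘ e) a₀ Z := by
    have h3 := (hF.hasFDerivAt.log hpos.ne').fderiv
    have h4 : mvfderiv 𝓘(ℝ, V) ((fun p => Real.log (f p)) ∘ e) a₀ Z =
        fderiv ℝ (fun a => Real.log ((f ∘ e) a)) a₀ Z := by
      rw [mvfderiv]
      simp only [mfderiv_eq_fderiv]
      rfl
    rw [h4, h3]
    rfl
  rw [← h1, h2]
  have h5 := ((hF.hasFDerivAt.pow 2).mul_const c).fderiv
  have h6 := congr($h5 Z)
  refine h6.trans ?_
  simp only [smul_apply, smul_eq_mul, Function.comp_apply, two_nsmul]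
  have := hpos.ne'
  field_simp
  ring

end Geodesic

/-! ### Transfer of the local identity to the warped product. -/

section Main

variable {E : Type*} [NormedAddCommGroup E] [NormedSpace ℝ E] [FiniteDimensional ℝ E]
  {N : Type*} [TopologicalSpace N] [ChartedSpace E N] [IsManifold 𝓘(ℝ, E) ∞ N]
  [RiemannianBundle (fun x : N => TangentSpace 𝓘(ℝ, E) x)]
  [IsContMDiffRiemannianBundle 𝓘(ℝ, E) ∞ E (fun x : N => TangentSpace 𝓘(ℝ, E) x)]
  {E₁ : Type*} [NormedAddCommGroup E₁] [NormedSpace ℝ E₁] [FiniteDimensional ℝ E₁]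
  {M₁ : Type*} [TopologicalSpace M₁] [ChartedSpace E₁ M₁] [IsManifold 𝓘(ℝ, E₁) ∞ M₁]
  [RiemannianBundle (fun p : M₁ => TangentSpace 𝓘(ℝ, E₁) p)]
  [IsContMDiffRiemannianBundle 𝓘(ℝ, E₁) ∞ E₁ (fun p : M₁ => TangentSpace 𝓘(ℝ, E₁) p)]
  {E₂ : Type*} [NormedAddCommGroup E₂] [NormedSpace ℝ E₂] [FiniteDimensional ℝ E₂]
  {M₂ : Type*} [TopologicalSpace M₂] [ChartedSpace E₂ M₂] [IsManifold 𝓘(ℝ, E₂) ∞ M₂]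
  [RiemannianBundle (fun q : M₂ => TangentSpace 𝓘(ℝ, E₂) q)]
  [IsContMDiffRiemannianBundle 𝓘(ℝ, E₂) ∞ E₂ (fun q : M₂ => TangentSpace 𝓘(ℝ, E₂) q)]

/-- The warping function of a totally geodesic pseudo-slant warped product whose slant factor is
positive-dimensional and not anti-invariant. -/
theorem mvfderiv_log_warping_eq {s : ℕ} {S : FramedMetricFStructure E N s}
    {D : CovariantDerivative 𝓘(ℝ, E) E (fun x : N => TangentSpace 𝓘(ℝ, E) x)}
    (hD : IsLeviCivita D) (hS : IsNearlyKenmotsu S D)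
    {f : M₁ → ℝ} (hf : MDifferentiable 𝓘(ℝ, E₁) 𝓘(ℝ, ℝ) f) (hf_pos : ∀ p, 0 < f p)
    {ι : M₁ × M₂ → N} (hι : ContMDiff (𝓘(ℝ, E₁).prod 𝓘(ℝ, E₂)) 𝓘(ℝ, E) ∞ ι)
    (hwarped : IsWarpedProductIsometric (E₁ := E₁) (E₂ := E₂) (E := E) f ι) {θ : ℝ}
    (hslant : IsPseudoSlant (E₁ := E₁) (E₂ := E₂) S ι θ)
    (hgeod : IsTotallyGeodesic (𝓘(ℝ, E₁).prod 𝓘(ℝ, E₂)) D ι)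
    (hθ : Real.cos θ ≠ 0) [Nontrivial E₂] (p : M₁) (q : M₂) (Z : TangentSpace 𝓘(ℝ, E₁) p) :
    mvfderiv 𝓘(ℝ, E₁) (fun p => Real.log (f p)) p Z =
      ∑ k, S.η k (ι (p, q)) (mfderiv 𝓘(ℝ, E₁) 𝓘(ℝ, E) (fun p => ι (p, q)) p Z) := by
  obtain ⟨e₁, a₀, rfl, he₁, hn₁⟩ := exists_local_parametrization (F := E₁) p
  obtain ⟨e₂, b₀, rfl, he₂, hn₂⟩ := exists_local_parametrization (F := E₂) q
  have hιd : MDifferentiable (𝓘(ℝ, E₁).prod 𝓘(ℝ, E₂)) 𝓘(ℝ, E) ι := hι.mdifferentiable (by simp)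
  let j : E₁ × E₂ → N := fun u => ι (e₁ u.1, e₂ u.2)
  let σ₁ : ∀ a : E₁, E₁ →L[ℝ] TangentSpace 𝓘(ℝ, E₁) (e₁ a) := mfderiv 𝓘(ℝ, E₁) 𝓘(ℝ, E₁) e₁
  let σ₂ : ∀ b : E₂, E₂ →L[ℝ] TangentSpace 𝓘(ℝ, E₂) (e₂ b) := mfderiv 𝓘(ℝ, E₂) 𝓘(ℝ, E₂) e₂
  have he : ∀ᶠ u : E₁ × E₂ in 𝓝 (a₀, b₀),
      (ContMDiffAt 𝓘(ℝ, E₁) 𝓘(ℝ, E₁) ∞ e₁ u.1 ∧ Function.Bijective (σ₁ u.1)) ∧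
      (ContMDiffAt 𝓘(ℝ, E₂) 𝓘(ℝ, E₂) ∞ e₂ u.2 ∧ Function.Bijective (σ₂ u.2)) := by
    rw [nhds_prod_eq]
    refine Filter.Eventually.prod_mk
      (pa := fun a => ContMDiffAt 𝓘(ℝ, E₁) 𝓘(ℝ, E₁) ∞ e₁ a ∧ Function.Bijective (σ₁ a))
      (pb := fun b => ContMDiffAt 𝓘(ℝ, E₂) 𝓘(ℝ, E₂) ∞ e₂ b ∧ Function.Bijective (σ₂ b))
      (he₁.mono fun a ha => ⟨ha.1, ?_⟩) (he₂.mono fun b hb => ⟨hb.1, ?_⟩)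
    · exact ha.2.bijective
    · exact hb.2.bijective
  have hcoord : ∀ᶠ u : E₁ × E₂ in 𝓝 (a₀, b₀), ∀ a b,
      coordField (E := E) j (a, b) u = prodDeriv ι (e₁ u.1, e₂ u.2) (σ₁ u.1 a) (σ₂ u.2 b) :=
    he.mono fun u hu a b => coordField_prodMap (hιd _) (hu.1.1.mdifferentiableAt (by simp))
      (hu.2.1.mdifferentiableAt (by simp)) a b
  have he₀ := he.self_of_nhds
  have hcoord₀ := hcoord.self_of_nhds
  have hj : ContMDiffAt 𝓘(ℝ, E₁ × E₂) 𝓘(ℝ, E) ∞ j (a₀, b₀) := by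
    have h1 : ContMDiffAt 𝓘(ℝ, E₁ × E₂) 𝓘(ℝ, E₁) ∞ (e₁ ∘ Prod.fst) (a₀, b₀) :=
      ContMDiffAt.comp (a₀, b₀) he₀.1.1 contDiffAt_fst.contMDiffAt
    have h2 : ContMDiffAt 𝓘(ℝ, E₁ × E₂) 𝓘(ℝ, E₂) ∞ (e₂ ∘ Prod.snd) (a₀, b₀) :=
      ContMDiffAt.comp (a₀, b₀) he₀.2.1 contDiffAt_snd.contMDiffAt
    exact ContMDiffAt.comp (a₀, b₀) (hι _) (h1.prodMk h2)
  have hinj : Function.Injective (mfderiv 𝓘(ℝ, E₁ × E₂) 𝓘(ℝ, E) j (a₀, b₀)) := by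
    rw [injective_iff_map_eq_zero]
    rintro ⟨a, b⟩ hab
    have h1 := (hcoord₀ a b).symm.trans hab
    obtain ⟨ha, hb⟩ := hwarped.prodDeriv_eq_zero (hf_pos _) h1
    exact Prod.ext (he₀.1.2.1 (ha.trans (map_zero _).symm))
      (he₀.2.2.1 (hb.trans (map_zero _).symm))
  have hrange : ∀ᶠ u : E₁ × E₂ in 𝓝 (a₀, b₀), ∀ v : TangentSpace 𝓘(ℝ, E) (j u),
      v ∈ tangent (𝓘(ℝ, E₁).prod 𝓘(ℝ, E₂)) ι (e₁ u.1, e₂ u.2) ↔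
        ∃ w, v = coordField j w u := by
    filter_upwards [he, hcoord] with u hu hc v
    rw [mem_tangent_iff]
    constructor
    · rintro ⟨a, b, rfl⟩
      obtain ⟨a', rfl⟩ := hu.1.2.2 a
      obtain ⟨b', rfl⟩ := hu.2.2.2 b
      exact ⟨(a', b'), (hc a' b').symm⟩
    · rintro ⟨⟨a', b'⟩, rfl⟩
      exact ⟨_, _, (hc a' b').symm⟩
  have hrange₀ := hrange.self_of_nhds
  -- The coordinate vectors `b`, `b'` stay fixed nearby: equality in the slant estimate is arranged
  -- only at the base point, which suffices for an extremum.
  obtain ⟨b, hb⟩ := exists_ne (0 : E₂)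
  have hb' : σ₂ b₀ b ≠ 0 := fun h => hb (he₀.2.2.1 (h.trans (map_zero _).symm))
  obtain ⟨v', hv1, hv2⟩ := hslant.exists_inner_φ_second_sq_eq (x := (e₁ a₀, e₂ b₀)) hwarped
    (hf_pos _) (hιd _) hθ hb'
  obtain ⟨b', rfl⟩ := he₀.2.2.2 v'
  obtain ⟨Z', rfl⟩ := he₀.1.2.2 Z
  have hfirst : ∀ᶠ u : E₁ × E₂ in 𝓝 (a₀, b₀), ∀ a,
      coordField (E := E) j (a, 0) u = prodDeriv ι (e₁ u.1, e₂ u.2) (σ₁ u.1 a) 0 :=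
    hcoord.mono fun u hu a => by rw [hu, map_zero]
  have hsecond : ∀ᶠ u : E₁ × E₂ in 𝓝 (a₀, b₀), ∀ b,
      coordField (E := E) j (0, b) u = prodDeriv ι (e₁ u.1, e₂ u.2) 0 (σ₂ u.2 b) :=
    hcoord.mono fun u hu b => by rw [hu, map_zero]
  have hfirst₀ := hfirst.self_of_nhds
  have hsecond₀ := hsecond.self_of_nhds
  have key := warping_eq_sum_η S D hD hS hj hinj (Z := Z')
    (μ := mvfderiv 𝓘(ℝ, E₁) (fun p => Real.log (f p)) (e₁ a₀) (σ₁ a₀ Z')) (b := b) (b' := b')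
    (c := Real.cos θ ^ 2) ?_ ?_ ?_ ?_ ?_ ?_ ?_ ?_
  · rw [key]
    refine Finset.sum_congr rfl fun k _ => ?_
    rw [hfirst₀]
    exact congrArg _ (mfderiv_left (x := (e₁ a₀, e₂ b₀)) (hιd _) (σ₁ a₀ Z')).symm
  · filter_upwards [hfirst, hsecond] with u h1 h2 a b
    rw [h1, h2, hwarped.inner_prodDeriv]
    simp
  · filter_upwards [hfirst, hcoord] with u h1 h2 a w
    rw [h1, h2 w.1 w.2]
    exact hslant.inner_φ_first (hιd _) _ _ _
  · intro k b
    rw [hsecond₀]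
    exact hslant.η_second hwarped (hιd _) k _
  · intro w Y hY hYt
    refine (hrange₀ _).1 (hgeod.covariantDerivative_mem (x := (e₁ a₀, e₂ b₀))
      ((hrange₀ _).2 ⟨w, rfl⟩) hY ?_)
    have h1 : 𝓝 (e₁ a₀, e₂ b₀) ≤ Filter.map (Prod.map e₁ e₂) (𝓝 (a₀, b₀)) := by
      rw [nhds_prod_eq, nhds_prod_eq, ← Filter.prod_map_map_eq']
      exact Filter.prod_mono hn₁ hn₂
    refine h1 (Filter.mem_map.2 ?_)
    filter_upwards [hYt, hrange] with u h2 h3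
    exact (h3 _).2 h2
  · intro c c'
    -- With the `M_θ` coordinate frozen, the `g_θ` factor is constant and only f² varies, giving the
    -- logarithmic derivative 2μ.
    have h1 : (fun a => (inner ℝ (coordField (E := E) j (0, c) (a, b₀))
        (coordField j (0, c') (a, b₀)) : ℝ)) =ᶠ[𝓝 a₀]
        fun a => f (e₁ a) ^ 2 * (inner ℝ (σ₂ b₀ c) (σ₂ b₀ c') : ℝ) := by
      have h2 : Filter.Tendsto (fun a : E₁ => (a, b₀)) (𝓝 a₀) (𝓝 (a₀, b₀)) :=
        (Continuous.prodMk continuous_id continuous_const).tendsto a₀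
      filter_upwards [h2.eventually hsecond] with a h3
      rw [h3, h3, hwarped.inner_prodDeriv, inner_zero_left, zero_add]
    rw [h1.fderiv_eq]
    refine Eq.trans ?_ (congrArg _ h1.self_of_nhds.symm)
    exact fderiv_sq_mul_const_eq_mvfderiv_log (hf _) (hf_pos _) (he₀.1.1.mdifferentiableAt (by simp)) _ _
  · filter_upwards [hsecond] with u h1
    rw [h1, h1]
    exact hslant.inner_φ_second_sq_le hwarped (hιd _) _ _
  · rw [hsecond₀, hsecond₀]
    exact hv1
  · rw [hsecond₀, hsecond₀]
    exact hv2

end Main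

end WarpedPseudoSlant

theorem mainTheorem3
    {E : Type*} [NormedAddCommGroup E] [NormedSpace ℝ E] [FiniteDimensional ℝ E]
    {N : Type*} [TopologicalSpace N] [ChartedSpace E N] [IsManifold 𝓘(ℝ, E) ∞ N]
    [RiemannianBundle (fun x : N => TangentSpace 𝓘(ℝ, E) x)]
    [IsContMDiffRiemannianBundle 𝓘(ℝ, E) ∞ E (fun x : N => TangentSpace 𝓘(ℝ, E) x)]
    {E₁ : Type*} [NormedAddCommGroup E₁] [NormedSpace ℝ E₁] [FiniteDimensional ℝ E₁]
    {M₁ : Type*} [TopologicalSpace M₁] [ChartedSpace E₁ M₁] [IsManifold 𝓘(ℝ, E₁) ∞ M₁]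
    [RiemannianBundle (fun p : M₁ => TangentSpace 𝓘(ℝ, E₁) p)]
    [IsContMDiffRiemannianBundle 𝓘(ℝ, E₁) ∞ E₁ (fun p : M₁ => TangentSpace 𝓘(ℝ, E₁) p)]
    {E₂ : Type*} [NormedAddCommGroup E₂] [NormedSpace ℝ E₂] [FiniteDimensional ℝ E₂]
    {M₂ : Type*} [TopologicalSpace M₂] [ChartedSpace E₂ M₂] [IsManifold 𝓘(ℝ, E₂) ∞ M₂]
    [RiemannianBundle (fun q : M₂ => TangentSpace 𝓘(ℝ, E₂) q)]
    [IsContMDiffRiemannianBundle 𝓘(ℝ, E₂) ∞ E₂ (fun q : M₂ => TangentSpace 𝓘(ℝ, E₂) q)]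
    {s : ℕ} (S : WarpedPseudoSlant.FramedMetricFStructure E N s)
    (D : CovariantDerivative 𝓘(ℝ, E) E (fun x : N => TangentSpace 𝓘(ℝ, E) x))
    (hD : WarpedPseudoSlant.IsLeviCivita D)
    (hS : WarpedPseudoSlant.IsNearlyKenmotsu S D)
    (f : M₁ → ℝ) (hf : ContMDiff 𝓘(ℝ, E₁) 𝓘(ℝ, ℝ) ∞ f) (hf_pos : ∀ p, 0 < f p)
    (ι : M₁ × M₂ → N)
    (hι : IsImmersion (𝓘(ℝ, E₁).prod 𝓘(ℝ, E₂)) 𝓘(ℝ, E) ∞ ι)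
    (hwarped : WarpedPseudoSlant.IsWarpedProductIsometric (E₁ := E₁) (E₂ := E₂) (E := E) f ι)
    (θ : ℝ)
    (hslant : WarpedPseudoSlant.IsPseudoSlant (E₁ := E₁) (E₂ := E₂) S ι θ)
    (hgeod : WarpedPseudoSlant.IsTotallyGeodesic (𝓘(ℝ, E₁).prod 𝓘(ℝ, E₂)) D ι) :
    WarpedPseudoSlant.IsAntiInvariant (𝓘(ℝ, E₁).prod 𝓘(ℝ, E₂)) S ι ∨
    WarpedPseudoSlant.IsInvariant (𝓘(ℝ, E₁).prod 𝓘(ℝ, E₂)) S ι ∨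
    ∀ (p : M₁) (q : M₂) (Z : TangentSpace 𝓘(ℝ, E₁) p),
      mvfderiv 𝓘(ℝ, E₁) (fun p => Real.log (f p)) p Z =
        ∑ k, S.η k (ι (p, q)) (mfderiv 𝓘(ℝ, E₁) 𝓘(ℝ, E) (fun p => ι (p, q)) p Z) := by
  have hι' : ContMDiff (𝓘(ℝ, E₁).prod 𝓘(ℝ, E₂)) 𝓘(ℝ, E) ∞ ι := hι.contMDiff
  -- The zero-dimensional case is separate because the slant condition is then vacuous and `θ`
  -- carries no information.
  by_cases h : Real.cos θ = 0 ∨ Subsingleton E₂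
  · exact Or.inl (hslant.isAntiInvariant hwarped (hι'.mdifferentiable (by simp)) h)
  · rw [not_or, not_subsingleton_iff_nontrivial] at h
    have := h.2
    exact Or.inr (Or.inr fun p q Z => WarpedPseudoSlant.mvfderiv_log_warping_eq hD hS
      (hf.mdifferentiable (by simp)) hf_pos hι' hwarped hslant hgeod h.1 p q Z)
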